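/- Let $r\ge 1$ be an integer, $(S,\mathcal S)$ a measurable space, $h\colon S^r\to\mathbb R$ a function that is measurable for the product $\sigma$-algebra (not necessarily symmetric), and $(X_i)_{i\ge 1}$ an i.i.d. sequence of $S$-valued random variables on a probability space $(\Omega,\mathcal F,\mathbb P)$. For $n\ge r$ let $$U_n:=\sum_{1\le i_1<i_2<\dots<i_r\le n}h(X_{i_1},\dots,X_{i_r}).$$ Suppose that $h$ is completely degenerate: for every $q\in\{1,\dots,r\}$ and all $s_1,\dots,s_{r-1}\in S$, the random variable $h(s_1,\dots,s_{q-1},X_1,s_q,\dots,s_{r-1})$ is integrable and has expectation $0$. Then for all integers $N\ge r$ and all real $x,y>0$ with $x/y>3^r$, $$\mathbb P\Big(\max_{r\le n\le N}|U_n|>N^{r/2}x\Big)\le A_r\exp\Big(-\frac12\Big(\frac xy\Big)^{2/r}\Big)+B_r\int_1^{+\infty}\mathbb P\big(|h(X_1,\dots,X_r)|>y\,u^{1/2}C_r\big)(1+\ln u)^{r(r-1)/2}\,\mathrm du$$ (the integral may be $+\infty$), where, with $\kappa_q:=1$ for $0\le q\le 1$ and $\kappa_q:=e^{q-1}/q^q$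 for $q>1$, $$A_r:=4(1-2^{-r}),\qquad B_r:=2\prod_{i=1}^{r}2^{i-1}\kappa_{i-1}\Big(1+\ln\frac{\kappa_{i-1}}{\kappa_{2(i-1)}}\Big)^{i-1},\qquad C_r:=4^{-r/2}\prod_{i=1}^{r}\kappa_{i-1}^{1/2}.$$ In particular the right-hand side does not depend on $N$. -/

import Mathlib

open MeasureTheory ProbabilityTheory

noncomputable section

namespace UStat

/-- The increasing multi-indices `i₁ < i₂ < ⋯ < i_r` with entries in `{0, …, n - 1}`.
All sequences are indexed from `0`, so that `X 0, X 1, …` are the data `X₁, X₂, …`. -/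
def increasingIndices (r n : ℕ) : Finset (Fin r → ℕ) :=
  (Fintype.piFinset fun _ : Fin r => Finset.range n).filter fun i => ∀ a b, a < b → i a < i b

/-- The `U`-statistic of order `r`, kernel `h` and data `X`, built on the first `n` data. -/
def uStat {Ω S : Type*} {r : ℕ} (h : (Fin r → S) → ℝ) (X : ℕ → Ω → S) (n : ℕ) (ω : Ω) : ℝ :=
  ∑ i ∈ increasingIndices r n, h fun k => X (i k) ω

/-- Complete degeneracy of the kernel `h` for a random element `Y`: whatever the coordinate `q`
and whatever the values of the other coordinates, `h` is integrable and centred when the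
coordinate `q` is replaced by `Y` (the entry `s q` plays no role). -/
def IsDegenerate {Ω S : Type*} [MeasurableSpace Ω] {r : ℕ} (h : (Fin r → S) → ℝ) (Y : Ω → S)
    (μ : Measure Ω) : Prop :=
  ∀ (q : Fin r) (s : Fin r → S),
    Integrable (fun ω => h (Function.update s q (Y ω))) μ ∧
      ∫ ω, h (Function.update s q (Y ω)) ∂μ = 0

/-- `κ_q`, for a real number `q ≥ 0`. -/
def kappa (q : ℝ) : ℝ := if q ≤ 1 then 1 else Real.exp (q - 1) / q ^ q

/-- The constant `A_r`. -/
def constA (r : ℕ) : ℝ := 4 * (1 - (2 : ℝ) ^ (-(r : ℝ)))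

/-- The constant `B_r`. -/
def constB (r : ℕ) : ℝ :=
  2 * ∏ i ∈ Finset.range r,
    ((2 : ℝ) ^ i * kappa i) * (1 + Real.log (kappa i / kappa (2 * i))) ^ i

/-- The constant `C_r`. -/
def constC (r : ℕ) : ℝ :=
  (4 : ℝ) ^ (-(r : ℝ) / 2) * ∏ i ∈ Finset.range r, kappa i ^ ((1 : ℝ) / 2)

end UStat

end

/-! Truncate the kernel, recentre it, and control the two pieces by different moments. Clip $h$ at
level $b = yC_r$ and centre the clipped kernel in each coordinate in turn. The resulting $g$ is
completely degenerate and bounded by $2^r b \le y$. Since $h$ is already degenerate and centring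
contracts $L^2$, $h-g$ is no larger in $L^2$ than $h$ minus its truncation (`exists_centered_on`).

A completely degenerate $U$-statistic is a martingale whose increment, for a fixed newest datum, is
a degenerate $U$-statistic of one order less. If $E[A^{2m-1}B]=0$, then $\|A+B\|^2 \le
\|A\|^2+(2m-1)\|B\|^2$ in $L^{2m}$ (`rpow_integral_add_pow_le`). Summed along Pascal's rule this
gives $\|U_n\|^2 \le (2m-1)^r\binom nr\|h\|^2$ (`lintegral_uSeq_pow_le`). Doob's inequality passes
to the maximum (`measure_exists_lt_abs_le`), and $\binom Nr\le N^r/r!$ removes $N$.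

For $h-g$ take $m=1$: the layer-cake formula turns $E(h^2-b^2)_+$ into the tail integral, with a
coefficient at most $\prod\kappa_{i-1}\le B_r$. For $g$ and $r\ge2$ take $2m-1$ near $T/2$, where
$T=(x/y)^{2/r}$; this gives $e^{-T/2}$. For $r=1$ that choice falls short, and Hoeffding's
inequality replaces it. The logarithmic weight is at least $1$ and is simply dropped. -/

namespace UStat

/-! ### Independence as invariance under resampling one coordinate -/

section Resampling

variable {S : Type*} [MeasurableSpace S] (ν : Measure S) [IsProbabilityMeasure ν]

/-- The law of an i.i.d. sequence with common law `ν`. -/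
noncomputable abbrev seqLaw : Measure (ℕ → S) := Measure.infinitePi fun _ : ℕ => ν

/-- Both measures agree on cylinders. This invariance takes the place of conditioning: integrating
over the fresh value amounts to a conditional expectation given all the other data. -/
theorem measurePreserving_update (n : ℕ) :
    MeasurePreserving (fun p : (ℕ → S) × S => Function.update p.1 n p.2)
      ((seqLaw ν).prod ν) (seqLaw ν) := by
  classical
  have hm : Measurable (fun p : (ℕ → S) × S => Function.update p.1 n p.2) :=
    measurable_update'
  refine ⟨hm, Measure.eq_infinitePi _ fun s t ht => ?_⟩
  rw [Measure.map_apply hm (.pi s.countable_toSet fun _ _ => ht _)]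
  by_cases hn : n ∈ s
  · have : (fun p : (ℕ → S) × S => Function.update p.1 n p.2) ⁻¹' ((s : Set ℕ).pi t) =
        (((s.erase n : Finset ℕ) : Set ℕ).pi t) ×ˢ t n := by
      ext p
      simp only [Set.mem_preimage, Set.mem_pi, Finset.mem_coe, Set.mem_prod, Finset.mem_erase]
      constructor
      · intro h
        refine ⟨fun i hi => ?_, ?_⟩
        · simpa [Function.update_of_ne hi.1] using h i hi.2
        · simpa using h n hn
      · rintro ⟨h1, h2⟩ i hi
        by_cases hin : i = n
        · subst hin; simpa using h2
        · simpa [Function.update_of_ne hin] using h1 i ⟨hin, hi⟩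
    rw [this, Measure.prod_prod, Measure.infinitePi_pi _ (fun i _ => ht i),
      Finset.prod_erase_mul _ _ hn]
  · have : (fun p : (ℕ → S) × S => Function.update p.1 n p.2) ⁻¹' ((s : Set ℕ).pi t) =
        ((s : Set ℕ).pi t) ×ˢ Set.univ := by
      ext p
      simp only [Set.mem_preimage, Set.mem_pi, Finset.mem_coe, Set.mem_prod, Set.mem_univ,
        and_true]
      refine forall₂_congr fun i hi => ?_
      rw [Function.update_of_ne (ne_of_mem_of_not_mem hi hn)]
    rw [this, Measure.prod_prod, Measure.infinitePi_pi _ (fun i _ => ht i), measure_univ, mul_one]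

variable {ν}

theorem lintegral_resample (n : ℕ) {G : (ℕ → S) → ENNReal} (hG : Measurable G) :
    ∫⁻ ξ, G ξ ∂seqLaw ν = ∫⁻ ξ, ∫⁻ t, G (Function.update ξ n t) ∂ν ∂seqLaw ν := by
  rw [← (measurePreserving_update ν n).lintegral_comp hG]
  exact lintegral_prod _ (hG.comp measurable_update').aemeasurable

/-- With the fresh value outermost, it can be frozen as an argument of the kernel while the other
data are integrated. -/
theorem lintegral_resample_symm (n : ℕ) {G : (ℕ → S) → ENNReal} (hG : Measurable G) :
    ∫⁻ ξ, G ξ ∂seqLaw ν = ∫⁻ t, ∫⁻ ξ, G (Function.update ξ n t) ∂seqLaw ν ∂ν := by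
  rw [← (measurePreserving_update ν n).lintegral_comp hG]
  exact lintegral_prod_symm _ (hG.comp measurable_update').aemeasurable

theorem integral_resample (n : ℕ) {G : (ℕ → S) → ℝ} (hG : Integrable G (seqLaw ν)) :
    ∫ ξ, G ξ ∂seqLaw ν = ∫ ξ, ∫ t, G (Function.update ξ n t) ∂ν ∂seqLaw ν := by
  have hp := measurePreserving_update ν n
  have hi := hp.integrable_comp_of_integrable hG
  conv_lhs => rw [← hp.map_eq]
  rw [integral_map hp.measurable.aemeasurable (by rw [hp.map_eq]; exact hG.aestronglyMeasurable)]
  exact integral_prod _ hi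

end Resampling

/-! ### Recursion for $U$-statistics along the data -/

section Combinatorics

variable {S : Type*} {r : ℕ}

theorem mem_increasingIndices {n : ℕ} {i : Fin r → ℕ} :
    i ∈ increasingIndices r n ↔ (∀ k, i k < n) ∧ StrictMono i := by
  simp [increasingIndices, StrictMono]

/-- The `U`-statistic as a function of the sequence of data. -/
noncomputable abbrev uSeq (h : (Fin r → S) → ℝ) (n : ℕ) (ξ : ℕ → S) : ℝ :=
  uStat h (fun i (ξ : ℕ → S) => ξ i) n ξ

theorem uSeq_order_zero (h : (Fin 0 → S) → ℝ) (n : ℕ) (ξ : ℕ → S) :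
    uSeq h n ξ = h fun k => ξ k := by
  have : increasingIndices 0 n = {fun k : Fin 0 => (k : ℕ)} := by
    ext i
    simp only [mem_increasingIndices, Finset.mem_singleton]
    exact ⟨fun _ => Subsingleton.elim _ _, fun h => ⟨fun k => k.elim0, fun k => k.elim0⟩⟩
  simp only [uSeq, uStat, this, Finset.sum_singleton]

theorem uSeq_eq_zero_of_lt (h : (Fin r → S) → ℝ) {n : ℕ} (hn : n < r) (ξ : ℕ → S) :
    uSeq h n ξ = 0 := by
  have : increasingIndices r n = ∅ := by
    refine Finset.eq_empty_of_forall_notMem fun i hi => ?_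
    obtain ⟨h1, h2⟩ := mem_increasingIndices.1 hi
    have := Fintype.card_le_of_injective (fun k => (⟨i k, h1 k⟩ : Fin n))
      (fun a b hab => h2.injective (by simpa using hab))
    simp at this
    omega
  simp only [uSeq, uStat, this, Finset.sum_empty]

theorem strictMono_snoc {i : Fin r → ℕ} {n : ℕ} (hi : StrictMono i) (h : ∀ k, i k < n) :
    StrictMono (Fin.snoc i n : Fin (r + 1) → ℕ) := by
  intro a b hab
  induction b using Fin.lastCases with
  | last =>
    induction a using Fin.lastCases with
    | last => exact absurd hab (lt_irrefl _)
    | cast a => simpa using h a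
  | cast b =>
    induction a using Fin.lastCases with
    | last => exact absurd hab (not_lt.2 (Fin.le_last _))
    | cast a => simpa using hi (by simpa using hab)

/-- Split the multi-indices according to whether their largest entry is `n`. The increment is thus a
$U$-statistic of lower order in the earlier data, which drives the induction on moments. -/
theorem uSeq_succ (h : (Fin (r + 1) → S) → ℝ) (n : ℕ) (ξ : ℕ → S) :
    uSeq h (n + 1) ξ = uSeq h n ξ + uSeq (fun s => h (Fin.snoc s (ξ n))) n ξ := by
  classical
  have hdec : increasingIndices (r + 1) (n + 1) = increasingIndices (r + 1) n ∪
      (increasingIndices r n).image (fun i => (Fin.snoc i n : Fin (r + 1) → ℕ)) := by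
    ext i
    simp only [Finset.mem_union, Finset.mem_image, mem_increasingIndices]
    constructor
    · rintro ⟨h1, h2⟩
      by_cases hl : i (Fin.last r) = n
      · right
        refine ⟨Fin.init i, ⟨fun k => ?_, fun a b hab => ?_⟩, ?_⟩
        · rw [← hl]; exact h2 (Fin.castSucc_lt_last k)
        · exact h2 (by simpa using hab)
        · rw [← hl]; exact Fin.snoc_init_self i
      · left
        refine ⟨fun k => lt_of_le_of_lt (h2.monotone (Fin.le_last k)) ?_, h2⟩
        have := h1 (Fin.last r)
        omega
    · rintro (⟨h1, h2⟩ | ⟨j, ⟨h1, h2⟩, rfl⟩)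
      · exact ⟨fun k => (h1 k).trans (Nat.lt_succ_self n), h2⟩
      · refine ⟨fun k => ?_, strictMono_snoc h2 h1⟩
        induction k using Fin.lastCases with
        | last => simp
        | cast k => simpa using (h1 k).trans (Nat.lt_succ_self n)
  have hdisj : Disjoint (increasingIndices (r + 1) n)
      ((increasingIndices r n).image (fun i => (Fin.snoc i n : Fin (r + 1) → ℕ))) := by
    rw [Finset.disjoint_left]
    intro i hi hi'
    obtain ⟨j, -, rfl⟩ := Finset.mem_image.1 hi'
    have := (mem_increasingIndices.1 hi).1 (Fin.last r)
    simp at this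
  have hinj : Function.Injective (fun i : Fin r → ℕ => (Fin.snoc i n : Fin (r + 1) → ℕ)) :=
    fun a b hab => by
      have := congrArg Fin.init hab
      simpa using this
  simp only [uSeq, uStat]
  rw [hdec, Finset.sum_union hdisj, Finset.sum_image hinj.injOn]
  congr 1
  refine Finset.sum_congr rfl fun i _ => ?_
  congr 1
  funext k
  induction k using Fin.lastCases with
  | last => simp
  | cast k => simp

theorem uSeq_update (h : (Fin r → S) → ℝ) {n k : ℕ} (hk : n ≤ k) (ξ : ℕ → S) (t : S) :
    uSeq h n (Function.update ξ k t) = uSeq h n ξ := by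
  refine Finset.sum_congr rfl fun i hi => ?_
  congr 1
  funext j
  have := (mem_increasingIndices.1 hi).1 j
  exact Function.update_of_ne (by omega) _ _

theorem uSeq_congr (h : (Fin r → S) → ℝ) {n : ℕ} {ξ η : ℕ → S} (hξ : ∀ k < n, ξ k = η k) :
    uSeq h n ξ = uSeq h n η := by
  refine Finset.sum_congr rfl fun i hi => ?_
  congr 1
  funext j
  exact hξ _ ((mem_increasingIndices.1 hi).1 j)

theorem uSeq_add (g h : (Fin r → S) → ℝ) (n : ℕ) (ξ : ℕ → S) :
    uSeq (fun s => g s + h s) n ξ = uSeq g n ξ + uSeq h n ξ :=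
  Finset.sum_add_distrib

theorem uSeq_snoc_update (h : (Fin (r + 1) → S) → ℝ) (n : ℕ) (ξ : ℕ → S) (t : S) :
    uSeq (fun s => h (Fin.snoc s (Function.update ξ n t n))) n (Function.update ξ n t) =
      uSeq (fun s => h (Fin.snoc s t)) n ξ := by
  rw [uSeq_update _ le_rfl, Function.update_self]

theorem update_comp_val (ξ : ℕ → S) (t : S) :
    (fun k : Fin (r + 1) => Function.update ξ r t k) = Fin.snoc (fun k : Fin r => ξ k) t := by
  funext k
  induction k using Fin.lastCases with
  | last => simp
  | cast k =>
    rw [Fin.snoc_castSucc]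
    exact Function.update_of_ne (by simpa using k.2.ne) _ _

theorem update_comp_val_fin (ξ : ℕ → S) (q : Fin r) (t : S) :
    (fun k : Fin r => Function.update ξ q t k) = Function.update (fun k : Fin r => ξ k) q t := by
  funext k
  by_cases hk : k = q
  · subst hk; simp
  · rw [Function.update_of_ne hk, Function.update_of_ne (fun h => hk (Fin.ext h))]

theorem uSeq_one_succ (g : (Fin 1 → S) → ℝ) (n : ℕ) (ξ : ℕ → S) :
    uSeq g (n + 1) ξ = uSeq g n ξ + g fun _ => ξ n := by
  rw [uSeq_succ, uSeq_order_zero]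
  congr 2

theorem abs_uSeq_one_le {g : (Fin 1 → S) → ℝ} {b : ℝ} (hg : ∀ s, |g s| ≤ b) (n : ℕ) (ξ : ℕ → S) :
    |uSeq g n ξ| ≤ n * b := by
  induction n with
  | zero => rw [uSeq_eq_zero_of_lt g one_pos]; simp
  | succ n ih =>
    rw [uSeq_one_succ]
    push_cast
    linarith [abs_add_le (uSeq g n ξ) (g fun _ => ξ n), hg fun _ => ξ n]

variable [MeasurableSpace S]

theorem measurable_uSeq {h : (Fin r → S) → ℝ} (hh : Measurable h) (n : ℕ) :
    Measurable (uSeq h n) := by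
  refine Finset.measurable_sum _ fun i _ => hh.comp ?_
  exact measurable_pi_lambda _ fun k => measurable_pi_apply _

end Combinatorics

/-! ### Complete degeneracy and the martingale property -/

section Centered

variable {S : Type*} [MeasurableSpace S] {ν : Measure S} {r : ℕ}

/-- Complete degeneracy of a kernel with respect to a law on the space of data. -/
def Centered (ν : Measure S) (h : (Fin r → S) → ℝ) : Prop :=
  ∀ (q : Fin r) (s : Fin r → S), Integrable (fun t => h (Function.update s q t)) ν ∧
    ∫ t, h (Function.update s q t) ∂ν = 0

theorem Centered.snoc {h : (Fin (r + 1) → S) → ℝ} (hc : Centered ν h) (t : S) :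
    Centered ν fun s : Fin r → S => h (Fin.snoc s t) := by
  intro q s
  have := hc q.castSucc (Fin.snoc s t)
  simpa only [Fin.snoc_update] using this

theorem Centered.last {h : (Fin (r + 1) → S) → ℝ} (hc : Centered ν h) (s : Fin r → S) :
    Integrable (fun t => h (Fin.snoc s t)) ν ∧ ∫ t, h (Fin.snoc s t) ∂ν = 0 := by
  rcases isEmpty_or_nonempty S with hS | ⟨⟨t₀⟩⟩
  · have : ν = 0 := Measure.eq_zero_of_isEmpty ν
    simp [this]
  · have := hc (Fin.last r) (Fin.snoc s t₀)
    simpa only [Fin.update_snoc_last] using this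

theorem Centered.integral_uSeq_snoc {h : (Fin (r + 1) → S) → ℝ} (hc : Centered ν h) (n : ℕ)
    (ξ : ℕ → S) : ∫ t, uSeq (fun s => h (Fin.snoc s t)) n ξ ∂ν = 0 := by
  simp only [uSeq, uStat]
  rw [integral_finsetSum _ fun i _ => (hc.last _).1]
  exact Finset.sum_eq_zero fun i _ => (hc.last _).2

theorem measurable_snoc :
    Measurable fun p : (Fin r → S) × S => (Fin.snoc p.1 p.2 : Fin (r + 1) → S) := by
  refine measurable_pi_lambda _ fun k => ?_
  induction k using Fin.lastCases with
  | last => simpa using measurable_snd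
  | cast k =>
    simp only [Fin.snoc_castSucc]
    exact (measurable_pi_apply k).comp measurable_fst

end Centered

/-! ### The two-point moment inequality -/

section EvenMoments

variable {Ω : Type*} [MeasurableSpace Ω] {μ : Measure Ω} {A B : Ω → ℝ}

theorem integrable_add_even_pow (hA : Measurable A) (hB : Measurable B) {m : ℕ}
    (hAi : Integrable (fun ω => A ω ^ (2 * m)) μ) (hBi : Integrable (fun ω => B ω ^ (2 * m)) μ)
    (c : ℝ) : Integrable (fun ω => (|A ω| + c * |B ω|) ^ (2 * m)) μ := by
  have hi : Integrable (fun ω => 2 ^ (2 * m - 1) * (A ω ^ (2 * m) + c ^ (2 * m) * B ω ^ (2 * m))) μ :=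
    (hAi.add (hBi.const_mul _)).const_mul _
  refine hi.mono' (by fun_prop) (Filter.Eventually.of_forall fun ω => ?_)
  have h := add_pow_le (abs_nonneg (A ω)) (abs_nonneg (c * |B ω|)) (2 * m)
  have e : Even (2 * m) := even_two_mul m
  rw [Real.norm_eq_abs, abs_of_nonneg (e.pow_nonneg _)]
  have h1 : (|A ω| + c * |B ω|) ^ (2 * m) ≤ (|A ω| + |c * abs (B ω)|) ^ (2 * m) := by
    rw [← e.pow_abs (|A ω| + c * |B ω|)]
    refine pow_le_pow_left₀ (abs_nonneg _) ?_ _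
    refine (abs_add_le _ _).trans (le_of_eq ?_)
    rw [abs_abs]
  refine h1.trans (h.trans (le_of_eq ?_))
  rw [e.pow_abs, e.pow_abs, mul_pow, e.pow_abs]

/-- Differentiation keeps the total degree `2 * m`, so one dominating function serves for both the
first and the second derivative of $t\mapsto E(A+tB)^{2m}$. -/
theorem hasDerivAt_integral_pow_mul_pow (hA : Measurable A) (hB : Measurable B) {m : ℕ}
    (hAi : Integrable (fun ω => A ω ^ (2 * m)) μ) (hBi : Integrable (fun ω => B ω ^ (2 * m)) μ)
    {j l : ℕ} (hjl : j + 1 + l = 2 * m) (t : ℝ) :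
    HasDerivAt (fun t : ℝ => ∫ ω, (A ω + t * B ω) ^ (j + 1) * B ω ^ l ∂μ)
      ((j + 1) * ∫ ω, (A ω + t * B ω) ^ j * B ω ^ (l + 1) ∂μ) t := by
  have key : ∀ (c : ℝ), 1 ≤ c → ∀ u, |u| ≤ c → ∀ i k, i + k = 2 * m → ∀ ω,
      ‖(A ω + u * B ω) ^ i * B ω ^ k‖ ≤ (|A ω| + c * |B ω|) ^ (2 * m) := by
    intro c hc u hu i k hik ω
    rw [norm_mul, norm_pow, norm_pow, Real.norm_eq_abs, Real.norm_eq_abs, ← hik, pow_add]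
    have h0 : |A ω + u * B ω| ≤ |A ω| + c * |B ω| := by
      refine (abs_add_le _ _).trans ?_
      rw [abs_mul]
      gcongr
    have h1 : |B ω| ≤ |A ω| + c * |B ω| := by
      nlinarith [abs_nonneg (A ω), abs_nonneg (B ω)]
    gcongr
  -- The constant `|t| + 1` bounds `|u|` on the unit ball around `t`, and being at least one it also
  -- lets the dominating function control `|B ω|` alone.
  have hc : 1 ≤ |t| + 1 := by linarith [abs_nonneg t]
  have hbound : ∀ u ∈ Metric.ball t 1, |u| ≤ |t| + 1 := by
    intro u hu
    have h1 : |u - t| < 1 := by simpa [Real.dist_eq] using hu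
    have := abs_add_le (u - t) t
    rw [sub_add_cancel] at this
    linarith
  have hI := integrable_add_even_pow hA hB hAi hBi (|t| + 1)
  rw [← integral_const_mul]
  refine (hasDerivAt_integral_of_dominated_loc_of_deriv_le
    (F := fun t ω => (A ω + t * B ω) ^ (j + 1) * B ω ^ l)
    (F' := fun t ω => (j + 1) * ((A ω + t * B ω) ^ j * B ω ^ (l + 1)))
    (bound := fun ω => (j + 1) * (|A ω| + (|t| + 1) * |B ω|) ^ (2 * m))
    (Metric.ball_mem_nhds t one_pos) ?_ ?_ ?_ ?_ (hI.const_mul _) ?_).2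
  · exact Filter.Eventually.of_forall fun u => by fun_prop
  · refine hI.mono' (by fun_prop) (Filter.Eventually.of_forall fun ω => ?_)
    exact key _ hc t (by linarith) _ _ hjl ω
  · fun_prop
  · refine Filter.Eventually.of_forall fun ω u hu => ?_
    rw [norm_mul, Real.norm_of_nonneg (by positivity)]
    gcongr
    exact key _ hc u (hbound u hu) _ _ (by omega) ω
  · refine Filter.Eventually.of_forall fun ω u _ => ?_
    have h1 : HasDerivAt (fun u : ℝ => A ω + u * B ω) (B ω) u := by
      simpa using ((hasDerivAt_id u).mul_const (B ω)).const_add (A ω)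
    refine ((h1.pow (j + 1)).mul_const (B ω ^ l)).congr_deriv ?_
    push_cast
    ring

/-- Hölder's inequality for even powers. -/
theorem integral_pow_mul_sq_le {m : ℕ} (hm : 1 ≤ m)
    (hAi : Integrable (fun ω => A ω ^ (2 * m)) μ) (hBi : Integrable (fun ω => B ω ^ (2 * m)) μ)
    {a b : ℝ} (ha : 0 < a) (hb : 0 < b) (haA : ∫ ω, A ω ^ (2 * m) ∂μ ≤ a)
    (hbB : ∫ ω, B ω ^ (2 * m) ∂μ ≤ b) :
    ∫ ω, A ω ^ (2 * m - 2) * B ω ^ 2 ∂μ ≤ a ^ (1 - (1 : ℝ) / m) * b ^ ((1 : ℝ) / m) := by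
  have hm0 : (0 : ℝ) < m := by exact_mod_cast hm
  have hw : 0 ≤ 1 - (1 : ℝ) / m := by
    rw [sub_nonneg, div_le_one hm0]; exact_mod_cast hm
  -- Weighted arithmetic-geometric mean for the normalised powers. Here `a` and `b` are positive
  -- upper bounds rather than the moments themselves, which leaves room for a later regularisation.
  have hpt : ∀ ω, A ω ^ (2 * m - 2) * B ω ^ 2 ≤ (a ^ (1 - (1 : ℝ) / m) * b ^ ((1 : ℝ) / m)) *
      ((1 - (1 : ℝ) / m) * (A ω ^ (2 * m) / a) + (1 : ℝ) / m * (B ω ^ (2 * m) / b)) := by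
    intro ω
    have hA0 : 0 ≤ A ω ^ (2 * m) := (even_two_mul m).pow_nonneg _
    have hB0 : 0 ≤ B ω ^ (2 * m) := (even_two_mul m).pow_nonneg _
    have h := Real.geom_mean_le_arith_mean2_weighted hw (by positivity : 0 ≤ (1 : ℝ) / m)
      (div_nonneg hA0 ha.le) (div_nonneg hB0 hb.le) (by ring)
    have e1 : A ω ^ (2 * m - 2) = (A ω ^ (2 * m)) ^ (1 - (1 : ℝ) / m) := by
      have : A ω ^ (2 * m) = (A ω ^ 2) ^ (m : ℝ) := by rw [Real.rpow_natCast, pow_mul]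
      rw [this, ← Real.rpow_mul (sq_nonneg _)]
      have : (m : ℝ) * (1 - 1 / m) = ((m - 1 : ℕ) : ℝ) := by
        push_cast [hm]; field_simp
      rw [this, Real.rpow_natCast, ← pow_mul]
      congr 1; omega
    have e2 : B ω ^ 2 = (B ω ^ (2 * m)) ^ ((1 : ℝ) / m) := by
      have : B ω ^ (2 * m) = (B ω ^ 2) ^ (m : ℝ) := by rw [Real.rpow_natCast, pow_mul]
      rw [this, ← Real.rpow_mul (sq_nonneg _)]
      rw [mul_one_div_cancel hm0.ne', Real.rpow_one]
    rw [e1, e2]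
    rw [Real.div_rpow hA0 ha.le, Real.div_rpow hB0 hb.le, div_mul_div_comm,
      div_le_iff₀ (by positivity)] at h
    linarith
  have hi : Integrable (fun ω => (a ^ (1 - (1 : ℝ) / m) * b ^ ((1 : ℝ) / m)) *
      ((1 - (1 : ℝ) / m) * (A ω ^ (2 * m) / a) + (1 : ℝ) / m * (B ω ^ (2 * m) / b))) μ :=
    (((hAi.div_const _).const_mul _).add ((hBi.div_const _).const_mul _)).const_mul _
  have h0 : ∀ ω, 0 ≤ A ω ^ (2 * m - 2) * B ω ^ 2 := fun ω =>
    mul_nonneg (Even.pow_nonneg ⟨m - 1, by omega⟩ _) (sq_nonneg _)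
  refine (integral_mono_of_nonneg (Filter.Eventually.of_forall h0) hi
    (Filter.Eventually.of_forall hpt)).trans ?_
  rw [integral_const_mul, integral_add ((hAi.div_const _).const_mul _)
    ((hBi.div_const _).const_mul _), integral_const_mul, integral_const_mul, integral_div,
    integral_div]
  refine mul_le_of_le_one_right (by positivity) ?_
  have h1 : (∫ ω, A ω ^ (2 * m) ∂μ) / a ≤ 1 := (div_le_one ha).2 haA
  have h2 : (∫ ω, B ω ^ (2 * m) ∂μ) / b ≤ 1 := (div_le_one hb).2 hbB
  have h3 : 0 ≤ (1 : ℝ) / m := by positivity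
  nlinarith

/-- A function with `f f'' ≤ c f^{2-1/m}` grows, after taking the power `1/m`, at most
quadratically from a critical point. -/
theorem rpow_le_add_of_second_deriv_le {m : ℕ} (hm : 1 ≤ m) {f f₁ f₂ : ℝ → ℝ} {c : ℝ}
    (hf : ∀ t, HasDerivAt f (f₁ t) t) (hf₁ : ∀ t, HasDerivAt f₁ (f₂ t) t) (h0 : f₁ 0 = 0)
    (hpos : ∀ t, 0 < f t) (h2 : ∀ t, f₂ t ≤ 2 * m * c * f t ^ (1 - (1 : ℝ) / m)) :
    f 1 ^ ((1 : ℝ) / m) ≤ f 0 ^ ((1 : ℝ) / m) + c := by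
  have hm0 : (0 : ℝ) < m := by exact_mod_cast hm
  set q : ℝ := 1 / m with hq
  have hq0 : 0 < q := by positivity
  have hq1 : q ≤ 1 := by rw [hq, div_le_one hm0]; exact_mod_cast hm
  set χ : ℝ → ℝ := fun t => f₁ t * q * f t ^ (q - 1) - c * (2 * t) with hχ
  have hφ : ∀ t, HasDerivAt (fun t => f t ^ q - c * t ^ 2) (χ t) t := by
    intro t
    refine ((hf t).rpow_const (Or.inl (hpos t).ne')).sub ?_
    simpa using (hasDerivAt_pow 2 t).const_mul c
  have hχ' : ∀ t, HasDerivAt χ (f₂ t * q * f t ^ (q - 1) +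
      f₁ t * q * (f₁ t * (q - 1) * f t ^ (q - 1 - 1)) - c * 2) t := by
    intro t
    refine (((hf₁ t).mul_const q).mul ((hf t).rpow_const (Or.inl (hpos t).ne'))).sub ?_
    simpa using ((hasDerivAt_id t).const_mul 2).const_mul c
  have hχanti : Antitone χ := by
    refine antitone_of_hasDerivAt_nonpos hχ' fun t => ?_
    -- The term in the square of the first derivative has a favourable sign because the power `q ≤
    -- 1` is concave.
    have e1 : f₁ t * q * (f₁ t * (q - 1) * f t ^ (q - 1 - 1)) ≤ 0 := by
      have : f₁ t * q * (f₁ t * (q - 1) * f t ^ (q - 1 - 1)) =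
        -((f₁ t) ^ 2 * (q * (1 - q) * f t ^ (q - 1 - 1))) := by ring
      rw [this, neg_nonpos]
      have := Real.rpow_nonneg (hpos t).le (q - 1 - 1)
      have : 0 ≤ 1 - q := by linarith
      positivity
    have e2 : f₂ t * q * f t ^ (q - 1) ≤ c * 2 := by
      have hp : 0 < q * f t ^ (q - 1) := mul_pos hq0 (Real.rpow_pos_of_pos (hpos t) _)
      have := mul_le_mul_of_nonneg_right (h2 t) hp.le
      have e3 : f t ^ (1 - q) * f t ^ (q - 1) = 1 := by
        rw [← Real.rpow_add (hpos t)]; simp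
      have e4 : (m : ℝ) * q = 1 := by rw [hq]; field_simp
      calc f₂ t * q * f t ^ (q - 1) = f₂ t * (q * f t ^ (q - 1)) := by ring
        _ ≤ _ := this
        _ = 2 * c * (m * q) * (f t ^ (1 - q) * f t ^ (q - 1)) := by ring
        _ = c * 2 := by rw [e3, e4]; ring
    exact (by linarith : f₂ t * q * f t ^ (q - 1) +
      f₁ t * q * (f₁ t * (q - 1) * f t ^ (q - 1 - 1)) - c * 2 ≤ 0)
  have hanti : AntitoneOn (fun t => f t ^ q - c * t ^ 2) (Set.Ici 0) := by
    refine antitoneOn_of_hasDerivWithinAt_nonpos (f' := χ) (convex_Ici 0)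
      (fun t _ => (hφ t).continuousAt.continuousWithinAt)
      (fun t _ => (hφ t).hasDerivWithinAt) fun t ht => ?_
    rw [interior_Ici] at ht
    have := hχanti (le_of_lt ht)
    simpa [hχ, h0] using this
  have := hanti (Set.self_mem_Ici) (Set.mem_Ici.2 zero_le_one) zero_le_one
  simp only at this
  linarith

/-- Two-point form of the martingale moment inequality of Rio, for even exponents. -/
theorem rpow_integral_add_pow_le (hA : Measurable A) (hB : Measurable B) {m : ℕ} (hm : 1 ≤ m)
    (hAi : Integrable (fun ω => A ω ^ (2 * m)) μ) (hBi : Integrable (fun ω => B ω ^ (2 * m)) μ)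
    (h0 : ∫ ω, A ω ^ (2 * m - 1) * B ω ∂μ = 0) :
    (∫ ω, (A ω + B ω) ^ (2 * m) ∂μ) ^ ((1 : ℝ) / m) ≤
      (∫ ω, A ω ^ (2 * m) ∂μ) ^ ((1 : ℝ) / m) +
        (2 * m - 1) * (∫ ω, B ω ^ (2 * m) ∂μ) ^ ((1 : ℝ) / m) := by
  have hm0 : (0 : ℝ) < m := by exact_mod_cast hm
  obtain ⟨k, rfl⟩ : ∃ k, m = k + 1 := ⟨m - 1, by omega⟩
  have hBnn : 0 ≤ ∫ ω, B ω ^ (2 * (k + 1)) ∂μ :=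
    integral_nonneg fun ω => (even_two_mul _).pow_nonneg _
  -- Adding `ε` keeps the moment function positive, so its fractional power is differentiable; `ε`
  -- tends to zero at the end.
  have key : ∀ ε : ℝ, 0 < ε →
      (∫ ω, (A ω + B ω) ^ (2 * (k + 1)) ∂μ + ε) ^ ((1 : ℝ) / (k + 1 : ℕ)) ≤
      (∫ ω, A ω ^ (2 * (k + 1)) ∂μ + ε) ^ ((1 : ℝ) / (k + 1 : ℕ)) +
        (2 * (k + 1 : ℕ) - 1) *
          (∫ ω, B ω ^ (2 * (k + 1)) ∂μ + ε) ^ ((1 : ℝ) / (k + 1 : ℕ)) := by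
    intro ε hε
    have hd1 := fun t => (hasDerivAt_integral_pow_mul_pow hA hB hAi hBi (j := 2 * k + 1) (l := 0)
      (by omega) t).add_const ε
    have hd2 := fun t => (hasDerivAt_integral_pow_mul_pow hA hB hAi hBi (j := 2 * k) (l := 1)
      (by omega) t).const_mul ((2 * k + 1 : ℕ) + 1 : ℝ)
    have := rpow_le_add_of_second_deriv_le hm
      (c := (2 * (k + 1 : ℕ) - 1) *
          (∫ ω, B ω ^ (2 * (k + 1)) ∂μ + ε) ^ ((1 : ℝ) / (k + 1 : ℕ))) hd1 hd2 ?_ ?_ ?_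
    · simpa [mul_add] using this
    · have e : 2 * (k + 1) - 1 = 2 * k + 1 := by omega
      rw [e] at h0
      simp [h0]
    · intro t
      refine add_pos_of_nonneg_of_pos (integral_nonneg fun ω => ?_) hε
      have : 0 ≤ (A ω + t * B ω) ^ (2 * (k + 1)) := (even_two_mul _).pow_nonneg _
      simpa [mul_add] using this
    · intro t
      have hi : Integrable (fun ω => (A ω + t * B ω) ^ (2 * (k + 1))) μ := by
        refine (integrable_add_even_pow hA hB hAi hBi |t|).mono' (by fun_prop)
          (Filter.Eventually.of_forall fun ω => ?_)
        rw [norm_pow, Real.norm_eq_abs]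
        gcongr
        refine (abs_add_le _ _).trans ?_
        rw [abs_mul]
      have hnn : 0 ≤ ∫ ω, (A ω + t * B ω) ^ (2 * (k + 1)) ∂μ :=
        integral_nonneg fun ω => (even_two_mul _).pow_nonneg _
      have h := integral_pow_mul_sq_le hm hi hBi
        (add_pos_of_nonneg_of_pos hnn hε) (add_pos_of_nonneg_of_pos hBnn hε)
        (le_add_of_nonneg_right hε.le) (le_add_of_nonneg_right hε.le)
      have e : 2 * (k + 1) - 2 = 2 * k := by omega
      rw [e] at h
      have e2 : (2 * k + 1 + 1 : ℕ) = 2 * (k + 1) := by ring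
      simp only [pow_zero, mul_one, e2, Nat.reduceAdd] at h ⊢
      push_cast at h ⊢
      have h' := mul_le_mul_of_nonneg_left h
        (by positivity : 0 ≤ (2 * (k : ℝ) + 1 + 1) * (2 * k + 1))
      refine le_trans (le_of_eq ?_) (h'.trans (le_of_eq ?_)) <;> ring
  have hl : ∀ a : ℝ, 0 ≤ a → Filter.Tendsto (fun ε : ℝ => (a + ε) ^ ((1 : ℝ) / (k + 1 : ℕ)))
      (nhdsWithin 0 (Set.Ioi 0)) (nhds (a ^ ((1 : ℝ) / (k + 1 : ℕ)))) := by
    intro a _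
    have : ContinuousAt (fun ε : ℝ => (a + ε) ^ ((1 : ℝ) / (k + 1 : ℕ))) 0 :=
      (continuousAt_const.add continuousAt_id).rpow_const (Or.inr (by positivity))
    have h := this.tendsto
    rw [add_zero] at h
    exact h.mono_left nhdsWithin_le_nhds
  refine le_of_tendsto_of_tendsto
    (hl _ (integral_nonneg fun ω => (even_two_mul _).pow_nonneg _))
    ((hl _ (integral_nonneg fun ω => (even_two_mul _).pow_nonneg _)).add
      ((hl _ hBnn).const_mul _)) ?_
  filter_upwards [self_mem_nhdsWithin] with ε hε using key ε hε

end EvenMoments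

/-! ### The moment inequality for possibly infinite moments -/

section LintegralEvenMoments

variable {Ω : Type*} [MeasurableSpace Ω] {μ : Measure Ω} {A B : Ω → ℝ}

theorem integrable_even_pow_of_lintegral_ne_top (hA : Measurable A) {m : ℕ}
    (h : ∫⁻ ω, ENNReal.ofReal (A ω ^ (2 * m)) ∂μ ≠ ⊤) :
    Integrable (fun ω => A ω ^ (2 * m)) μ := by
  refine ⟨by fun_prop, ?_⟩
  rw [hasFiniteIntegral_iff_ofReal
    (Filter.Eventually.of_forall fun ω => (even_two_mul m).pow_nonneg _)]
  exact h.lt_top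

theorem integrable_pow_mul_of_even (hA : Measurable A) (hB : Measurable B) {m : ℕ} (hm : 1 ≤ m)
    (hAi : Integrable (fun ω => A ω ^ (2 * m)) μ) (hBi : Integrable (fun ω => B ω ^ (2 * m)) μ) :
    Integrable (fun ω => A ω ^ (2 * m - 1) * B ω) μ := by
  refine (integrable_add_even_pow hA hB hAi hBi 1).mono' (by fun_prop)
    (Filter.Eventually.of_forall fun ω => ?_)
  have e : 2 * m = 2 * m - 1 + 1 := by omega
  rw [norm_mul, norm_pow, Real.norm_eq_abs, Real.norm_eq_abs, one_mul]
  conv_rhs => rw [e, pow_succ]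
  gcongr
  · exact le_add_of_nonneg_right (abs_nonneg _)
  · exact le_add_of_nonneg_left (abs_nonneg _)

/-- Here `a` and `b` bound squared $L^{2m}$ norms, so the estimate is additive and can be iterated;
the finite bounds also supply integrability. -/
theorem lintegral_add_even_pow_le (hA : Measurable A) (hB : Measurable B) {m : ℕ} (hm : 1 ≤ m)
    {a b : ℝ} (ha : 0 ≤ a) (hb : 0 ≤ b)
    (hAa : ∫⁻ ω, ENNReal.ofReal (A ω ^ (2 * m)) ∂μ ≤ ENNReal.ofReal (a ^ m))
    (hBb : ∫⁻ ω, ENNReal.ofReal (B ω ^ (2 * m)) ∂μ ≤ ENNReal.ofReal (b ^ m))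
    (h0 : ∫ ω, A ω ^ (2 * m - 1) * B ω ∂μ = 0) :
    ∫⁻ ω, ENNReal.ofReal ((A ω + B ω) ^ (2 * m)) ∂μ ≤
      ENNReal.ofReal ((a + (2 * m - 1) * b) ^ m) := by
  have hm0 : m ≠ 0 := by omega
  have hm1 : (1 : ℝ) ≤ m := by exact_mod_cast hm
  have hnn : ∀ f : Ω → ℝ, ∀ ω, 0 ≤ f ω ^ (2 * m) := fun f ω => (even_two_mul m).pow_nonneg _
  have hAi := integrable_even_pow_of_lintegral_ne_top hA (hAa.trans_lt ENNReal.ofReal_lt_top).ne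
  have hBi := integrable_even_pow_of_lintegral_ne_top hB (hBb.trans_lt ENNReal.ofReal_lt_top).ne
  have hSi : Integrable (fun ω => (A ω + B ω) ^ (2 * m)) μ := by
    refine (integrable_add_even_pow hA hB hAi hBi 1).mono' (by fun_prop)
      (Filter.Eventually.of_forall fun ω => ?_)
    rw [norm_pow, Real.norm_eq_abs, one_mul]
    gcongr
    exact abs_add_le _ _
  rw [← ofReal_integral_eq_lintegral_ofReal hAi (Filter.Eventually.of_forall (hnn A)),
    ENNReal.ofReal_le_ofReal_iff (by positivity)] at hAa
  rw [← ofReal_integral_eq_lintegral_ofReal hBi (Filter.Eventually.of_forall (hnn B)),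
    ENNReal.ofReal_le_ofReal_iff (by positivity)] at hBb
  rw [← ofReal_integral_eq_lintegral_ofReal hSi
    (Filter.Eventually.of_forall (hnn fun ω => A ω + B ω))]
  refine ENNReal.ofReal_le_ofReal ?_
  have hroot : ∀ {u v : ℝ}, 0 ≤ u → 0 ≤ v → u ≤ v ^ m → u ^ ((1 : ℝ) / m) ≤ v := by
    intro u v hu hv huv
    rw [one_div]
    exact (Real.rpow_le_rpow hu huv (by positivity)).trans
      (le_of_eq (Real.pow_rpow_inv_natCast hv hm0))
  have hk := rpow_integral_add_pow_le hA hB hm hAi hBi h0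
  have h1 := hroot (integral_nonneg (hnn A)) ha hAa
  have h2 := hroot (integral_nonneg (hnn B)) hb hBb
  have h3 : (2 * (m : ℝ) - 1) * (∫ ω, B ω ^ (2 * m) ∂μ) ^ ((1 : ℝ) / m) ≤ (2 * m - 1) * b :=
    mul_le_mul_of_nonneg_left h2 (by linarith)
  have h4 := hk.trans (add_le_add h1 h3)
  have hS0 : 0 ≤ ∫ ω, (A ω + B ω) ^ (2 * m) ∂μ := integral_nonneg (hnn fun ω => A ω + B ω)
  have h5 := pow_le_pow_left₀ (by positivity) h4 m
  rwa [one_div, Real.rpow_inv_natCast_pow hS0 hm0] at h5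

end LintegralEvenMoments

/-! ### Even moments of degenerate $U$-statistics -/

section Moments

variable {S : Type*} [MeasurableSpace S] {ν : Measure S} [IsProbabilityMeasure ν] {r : ℕ}

theorem measurable_uSeq_snoc_diag {h : (Fin (r + 1) → S) → ℝ} (hh : Measurable h) (n : ℕ) :
    Measurable fun ξ : ℕ → S => uSeq (fun s => h (Fin.snoc s (ξ n))) n ξ := by
  have : (fun ξ : ℕ → S => uSeq (fun s => h (Fin.snoc s (ξ n))) n ξ) =
      fun ξ => uSeq h (n + 1) ξ - uSeq h n ξ := by
    funext ξ; rw [uSeq_succ]; ring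
  rw [this]
  exact (measurable_uSeq hh _).sub (measurable_uSeq hh _)

/-- The increments of a completely degenerate `U`-statistic are orthogonal to the past. -/
theorem integral_mul_increment_eq_zero {h : (Fin (r + 1) → S) → ℝ} (hc : Centered ν h) (n : ℕ)
    {G : (ℕ → S) → ℝ} (hG : ∀ ξ t, G (Function.update ξ n t) = G ξ)
    (hi : Integrable (fun ξ => G ξ * uSeq (fun s => h (Fin.snoc s (ξ n))) n ξ) (seqLaw ν)) :
    ∫ ξ, G ξ * uSeq (fun s => h (Fin.snoc s (ξ n))) n ξ ∂seqLaw ν = 0 := by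
  rw [integral_resample n hi]
  simp only [uSeq_snoc_update, hG, integral_const_mul, hc.integral_uSeq_snoc, mul_zero,
    integral_zero]

theorem measurable_comp_val {E : Type*} [MeasurableSpace E] {h : (Fin r → S) → E}
    (hh : Measurable h) :
    Measurable fun ξ : ℕ → S => h fun k => ξ k :=
  hh.comp (measurable_pi_lambda _ fun _ => measurable_pi_apply _)

/-- Even moments of a completely degenerate `U`-statistic. -/
theorem lintegral_uSeq_pow_le {m : ℕ} (hm : 1 ≤ m) (n : ℕ) : ∀ {r : ℕ} (h : (Fin r → S) → ℝ),
    Measurable h → Centered ν h →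
    ∫⁻ ξ, ENNReal.ofReal (uSeq h n ξ ^ (2 * m)) ∂seqLaw ν ≤
      ENNReal.ofReal (((2 * m - 1 : ℝ) ^ r * n.choose r) ^ m) *
        ∫⁻ ξ, ENNReal.ofReal (h (fun k => ξ k) ^ (2 * m)) ∂seqLaw ν := by
  have hm1 : (1 : ℝ) ≤ m := by exact_mod_cast hm
  have hm2 : (0 : ℝ) < 2 * m - 1 := by linarith
  have hzero : ∀ {n r : ℕ} (h : (Fin r → S) → ℝ), n < r →
      ∫⁻ ξ, ENNReal.ofReal (uSeq h n ξ ^ (2 * m)) ∂seqLaw ν = 0 := by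
    intro n r h hn
    have : 2 * m ≠ 0 := by omega
    simp [uSeq_eq_zero_of_lt h hn, this]
  -- The order stays universally quantified, because the step applies the hypothesis to the kernel
  -- and to its sections of lower order.
  induction n with
  | zero =>
    intro r h hh hc
    cases r with
    | zero => simp [uSeq_order_zero]
    | succ r => rw [hzero h (Nat.succ_pos r)]; exact bot_le
  | succ n ih =>
    intro r h hh hc
    cases r with
    | zero => simp [uSeq_order_zero]
    | succ r =>
      by_cases hn : n + 1 < r + 1
      · rw [hzero h hn]; exact bot_le
      set I := ∫⁻ ξ, ENNReal.ofReal (h (fun k => ξ k) ^ (2 * m)) ∂seqLaw ν with hI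
      by_cases hIt : I = ⊤
      · have hpos : 0 < (n + 1).choose (r + 1) := Nat.choose_pos (by omega)
        rw [hIt, ENNReal.mul_top (by rw [Ne, ENNReal.ofReal_eq_zero, not_le]; positivity)]
        exact le_top
      -- The squared $L^{2m}$ norm of the kernel.
      set g : ℝ := I.toReal ^ ((m : ℝ)⁻¹) with hg
      have hg0 : 0 ≤ g := by positivity
      have hIg : I = ENNReal.ofReal (g ^ m) := by
        rw [hg, Real.rpow_inv_natCast_pow ENNReal.toReal_nonneg (by omega),
          ENNReal.ofReal_toReal hIt]
      have hAa := ih h hh hc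
      rw [← hI, hIg, ← ENNReal.ofReal_mul (by positivity), ← mul_pow] at hAa
      have hmB := measurable_uSeq_snoc_diag hh n
      have hBb : ∫⁻ ξ, ENNReal.ofReal (uSeq (fun s => h (Fin.snoc s (ξ n))) n ξ ^ (2 * m))
          ∂seqLaw ν ≤ ENNReal.ofReal (((2 * m - 1 : ℝ) ^ r * n.choose r * g) ^ m) := by
        rw [lintegral_resample_symm n (hmB.pow_const _).ennreal_ofReal]
        simp only [uSeq_snoc_update]
        rw [mul_pow _ g, ENNReal.ofReal_mul (by positivity), ← hIg, hI,
          lintegral_resample_symm r ((measurable_comp_val hh).pow_const _).ennreal_ofReal,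
          ← lintegral_const_mul]
        · refine lintegral_mono fun t => ?_
          simp only [update_comp_val]
          exact ih (fun s => h (Fin.snoc s t)) (hh.comp (measurable_snoc.comp
            (measurable_id.prodMk measurable_const))) (hc.snoc t)
        · refine Measurable.lintegral_prod_left' (f := fun p : (ℕ → S) × S =>
            ENNReal.ofReal (h (fun k => Function.update p.1 r p.2 k) ^ (2 * m))) ?_
          exact (((measurable_comp_val hh).comp measurable_update').pow_const _).ennreal_ofReal
      have hmA := measurable_uSeq hh n
      have h0 : ∫ ξ, uSeq h n ξ ^ (2 * m - 1) * uSeq (fun s => h (Fin.snoc s (ξ n))) n ξ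
          ∂seqLaw ν = 0 := by
        refine integral_mul_increment_eq_zero hc n (G := fun ξ => uSeq h n ξ ^ (2 * m - 1))
          (fun ξ t => by simp only [uSeq_update h le_rfl]) ?_
        exact integrable_pow_mul_of_even hmA hmB hm
          (integrable_even_pow_of_lintegral_ne_top hmA (hAa.trans_lt ENNReal.ofReal_lt_top).ne)
          (integrable_even_pow_of_lintegral_ne_top hmB (hBb.trans_lt ENNReal.ofReal_lt_top).ne)
      have := lintegral_add_even_pow_le hmA hmB hm (by positivity) (by positivity) hAa hBb h0
      simp only [← uSeq_succ] at this
      refine this.trans (le_of_eq ?_)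
      rw [hIg, ← ENNReal.ofReal_mul (by positivity), ← mul_pow]
      congr 2
      -- Pascal's rule: the extra factor `2 * m - 1` on the increment makes up for its lower order.
      rw [Nat.choose_succ_succ]
      push_cast
      ring

end Moments

/-! ### Doob's inequality for degenerate $U$-statistics -/

section Maximal

variable {S : Type*} [MeasurableSpace S] {ν : Measure S} [IsProbabilityMeasure ν] {r : ℕ}

/-- The filtration whose `n`-th term is generated by the first `n` data. -/
def pastFiltration (S : Type*) [MeasurableSpace S] :
    Filtration ℕ (inferInstance : MeasurableSpace (ℕ → S)) where
  seq n := MeasurableSpace.comap (fun ξ (i : Fin n) => ξ i) inferInstance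
  mono' := by
    intro n k hnk
    have : (fun (ξ : ℕ → S) (i : Fin n) => ξ i) =
        (fun (η : Fin k → S) (i : Fin n) => η (Fin.castLE hnk i)) ∘ fun ξ (i : Fin k) => ξ i := rfl
    dsimp only
    rw [this, ← MeasurableSpace.comap_comp]
    refine MeasurableSpace.comap_mono ?_
    exact (measurable_pi_lambda _ fun _ => measurable_pi_apply _ :
      Measurable fun (η : Fin k → S) (i : Fin n) => η (Fin.castLE hnk i)).comap_le
  le' n := (measurable_pi_lambda _ fun _ => measurable_pi_apply _ :
      Measurable fun (ξ : ℕ → S) (i : Fin n) => ξ i).comap_le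

theorem measurable_pastFiltration_uSeq [Nonempty S] {h : (Fin r → S) → ℝ} (hh : Measurable h)
    (n : ℕ) : Measurable[pastFiltration S n] (uSeq h n) := by
  obtain ⟨s₀⟩ := ‹Nonempty S›
  let ext : (Fin n → S) → ℕ → S := fun η i => if hi : i < n then η ⟨i, hi⟩ else s₀
  have hext : Measurable ext := by
    refine measurable_pi_lambda _ fun i => ?_
    by_cases hi : i < n
    · simpa [ext, hi] using measurable_pi_apply _
    · simp [ext, hi]
  have : uSeq h n = (uSeq h n ∘ ext) ∘ fun ξ (i : Fin n) => ξ i := by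
    funext ξ
    refine uSeq_congr (ξ := ξ) (η := ext fun i : Fin n => ξ i) h fun k hk => ?_
    simp [ext, hk]
  rw [this]
  exact ((measurable_uSeq hh n).comp hext).comp (comap_measurable _)

/-- Doob's maximal inequality for a convex function `φ`, with subgradient `ψ`, of a completely
degenerate `U`-statistic. -/
theorem measure_exists_le_le_integral {h : (Fin (r + 1) → S) → ℝ} (hh : Measurable h)
    (hc : Centered ν h) {φ ψ : ℝ → ℝ} (hφm : Measurable φ) (hφ : ∀ a, 0 ≤ φ a)
    (hsub : ∀ a b, φ a + ψ a * b ≤ φ (a + b))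
    (hint : ∀ n, Integrable (fun ξ => φ (uSeq h n ξ)) (seqLaw ν))
    (hint' : ∀ n, Integrable
      (fun ξ => ψ (uSeq h n ξ) * uSeq (fun s => h (Fin.snoc s (ξ n))) n ξ) (seqLaw ν))
    {ε : ℝ} (hε : 0 ≤ ε) (N : ℕ) :
    ENNReal.ofReal ε * seqLaw ν {ξ | ∃ n ≤ N, ε ≤ φ (uSeq h n ξ)} ≤
      ENNReal.ofReal (∫ ξ, φ (uSeq h N ξ) ∂seqLaw ν) := by
  have : Nonempty S := nonempty_of_isProbabilityMeasure ν
  have hsm : Submartingale (fun n ξ => φ (uSeq h n ξ)) (pastFiltration S) (seqLaw ν) := by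
    refine submartingale_of_setIntegral_le_succ (fun n =>
      (hφm.comp (measurable_pastFiltration_uSeq hh n)).stronglyMeasurable) hint ?_
    intro n s hs
    have hs' : MeasurableSet s := (pastFiltration S).le n s hs
    -- A past event is a condition on the first `n` data, hence insensitive to resampling coordinate
    -- `n`; its indicator may multiply the subgradient in the orthogonality relation.
    obtain ⟨A, hA, rfl⟩ := hs
    set s := (fun (ξ : ℕ → S) (i : Fin n) => ξ i) ⁻¹' A with hsdef
    have hz : ∫ ξ in s, ψ (uSeq h n ξ) * uSeq (fun s => h (Fin.snoc s (ξ n))) n ξ ∂seqLaw ν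
        = 0 := by
      rw [← integral_indicator hs']
      have e : s.indicator
          (fun ξ => ψ (uSeq h n ξ) * uSeq (fun s => h (Fin.snoc s (ξ n))) n ξ) =
          fun ξ => s.indicator (fun ξ => ψ (uSeq h n ξ)) ξ *
            uSeq (fun s => h (Fin.snoc s (ξ n))) n ξ := by
        funext ξ
        rw [Set.indicator_mul_left]
      rw [e]
      refine integral_mul_increment_eq_zero hc n (fun ξ t => ?_) ?_
      · have hmem : Function.update ξ n t ∈ s ↔ ξ ∈ s := by
          have : (fun i : Fin n => Function.update ξ n t i) = fun i : Fin n => ξ i := by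
            funext i
            exact Function.update_of_ne i.2.ne _ _
          simp only [hsdef, Set.mem_preimage, this]
        by_cases hξ : ξ ∈ s
        · rw [Set.indicator_of_mem (hmem.2 hξ), Set.indicator_of_mem hξ, uSeq_update h le_rfl]
        · rw [Set.indicator_of_notMem (fun hx => hξ (hmem.1 hx)), Set.indicator_of_notMem hξ]
      · rw [← e]
        exact (hint' n).indicator hs'
    calc ∫ ξ in s, φ (uSeq h n ξ) ∂seqLaw ν
        = ∫ ξ in s, (φ (uSeq h n ξ) +
            ψ (uSeq h n ξ) * uSeq (fun s => h (Fin.snoc s (ξ n))) n ξ) ∂seqLaw ν := by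
          rw [integral_add (hint n).integrableOn (hint' n).integrableOn, hz, add_zero]
      _ ≤ ∫ ξ in s, φ (uSeq h (n + 1) ξ) ∂seqLaw ν := by
          refine integral_mono ((hint n).add (hint' n)).integrableOn (hint (n + 1)).integrableOn
            fun ξ => ?_
          simp only [uSeq_succ]
          exact hsub _ _
  have hmax := maximal_ineq hsm (fun n ξ => hφ _) (ε := ⟨ε, hε⟩) N
  have hset : {ξ : ℕ → S | ∃ n ≤ N, ε ≤ φ (uSeq h n ξ)} =
      {ξ | ε ≤ (Finset.range (N + 1)).sup' Finset.nonempty_range_add_one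
        fun k => φ (uSeq h k ξ)} := by
    ext ξ
    simp only [Set.mem_ofPred_eq, Finset.le_sup'_iff, Finset.mem_range, Nat.lt_succ_iff]
  rw [hset]
  have hεe : ENNReal.ofReal ε = ((NNReal.mk ε hε : NNReal) : ENNReal) := by
    rw [ENNReal.ofReal, Real.toNNReal_of_nonneg hε]
  rw [hεe]
  refine hmax.trans (ENNReal.ofReal_le_ofReal ?_)
  exact setIntegral_le_integral (hint N) (Filter.Eventually.of_forall fun ξ => hφ _)

theorem even_pow_add_le (m : ℕ) (a b : ℝ) :
    a ^ (2 * m) + 2 * m * a ^ (2 * m - 1) * b ≤ (a + b) ^ (2 * m) := by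
  have hconv : ConvexOn ℝ Set.univ fun x : ℝ => x ^ (2 * m) := (even_two_mul m).convexOn_pow
  have hd : HasDerivAt (fun x : ℝ => x ^ (2 * m)) (2 * m * a ^ (2 * m - 1)) a := by
    simpa using hasDerivAt_pow (2 * m) a
  rcases lt_trichotomy b 0 with hb | rfl | hb
  · have h := hconv.slope_le_of_hasDerivAt (x := a + b) (y := a) trivial trivial (by linarith) hd
    rw [slope_def_field, div_le_iff₀ (by linarith)] at h
    nlinarith
  · simp
  · have h := hconv.le_slope_of_hasDerivAt (x := a) (y := a + b) trivial trivial (by linarith) hd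
    rw [slope_def_field, le_div_iff₀ (by linarith)] at h
    nlinarith

/-- Maximal inequality for a completely degenerate `U`-statistic in terms of an even moment of
the kernel. -/
theorem measure_exists_lt_abs_le {h : (Fin (r + 1) → S) → ℝ} (hh : Measurable h)
    (hc : Centered ν h) {m : ℕ} (hm : 1 ≤ m) {N : ℕ} (hN : r + 1 ≤ N) {l : ℝ} (hl : 0 < l) :
    seqLaw ν {ξ | ∃ n ≤ N, l < |uSeq h n ξ|} ≤
      ENNReal.ofReal (((2 * m - 1 : ℝ) ^ (r + 1) * N.choose (r + 1) / l ^ 2) ^ m) *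
        ∫⁻ ξ, ENNReal.ofReal (h (fun k => ξ k) ^ (2 * m)) ∂seqLaw ν := by
  have hm1 : (1 : ℝ) ≤ m := by exact_mod_cast hm
  have hm2 : (0 : ℝ) < 2 * m - 1 := by linarith
  have hpos : 0 < N.choose (r + 1) := Nat.choose_pos hN
  set I := ∫⁻ ξ, ENNReal.ofReal (h (fun k => ξ k) ^ (2 * m)) ∂seqLaw ν with hI
  by_cases hIt : I = ⊤
  · rw [hIt, ENNReal.mul_top (by rw [Ne, ENNReal.ofReal_eq_zero, not_le]; positivity)]
    exact le_top
  have hmom : ∀ n, ∫⁻ ξ, ENNReal.ofReal (uSeq h n ξ ^ (2 * m)) ∂seqLaw ν ≠ ⊤ := fun n =>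
    ((lintegral_uSeq_pow_le hm n h hh hc).trans_lt
      (ENNReal.mul_lt_top ENNReal.ofReal_lt_top (lt_top_iff_ne_top.2 hIt))).ne
  have hint : ∀ n, Integrable (fun ξ => uSeq h n ξ ^ (2 * m)) (seqLaw ν) := fun n =>
    integrable_even_pow_of_lintegral_ne_top (measurable_uSeq hh n) (hmom n)
  have hint' : ∀ n, Integrable (fun ξ => 2 * m * uSeq h n ξ ^ (2 * m - 1) *
      uSeq (fun s => h (Fin.snoc s (ξ n))) n ξ) (seqLaw ν) := by
    intro n
    have hBi : Integrable (fun ξ => uSeq (fun s => h (Fin.snoc s (ξ n))) n ξ ^ (2 * m))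
        (seqLaw ν) := by
      refine (integrable_add_even_pow (measurable_uSeq hh (n + 1)) (measurable_uSeq hh n)
        (hint (n + 1)) (hint n) 1).mono'
        ((measurable_uSeq_snoc_diag hh n).pow_const _).aestronglyMeasurable
        (Filter.Eventually.of_forall fun ξ => ?_)
      rw [norm_pow, Real.norm_eq_abs, one_mul]
      gcongr
      have : uSeq (fun s => h (Fin.snoc s (ξ n))) n ξ = uSeq h (n + 1) ξ - uSeq h n ξ := by
        rw [uSeq_succ]; ring
      rw [this]
      exact abs_sub _ _
    simp only [mul_assoc]
    have := integrable_pow_mul_of_even (measurable_uSeq hh n) (measurable_uSeq_snoc_diag hh n) hm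
      (hint n) hBi
    exact (this.const_mul (m : ℝ)).const_mul 2
  have hmax := measure_exists_le_le_integral hh hc (φ := fun a => a ^ (2 * m))
    (ψ := fun a => 2 * m * a ^ (2 * m - 1)) (by fun_prop)
    (fun a => (even_two_mul m).pow_nonneg _) (even_pow_add_le m) hint hint'
    (ε := l ^ (2 * m)) (by positivity) N
  rw [ofReal_integral_eq_lintegral_ofReal (hint N)
    (Filter.Eventually.of_forall fun ξ => (even_two_mul m).pow_nonneg _)] at hmax
  have hmono : seqLaw ν {ξ | ∃ n ≤ N, l < |uSeq h n ξ|} ≤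
      seqLaw ν {ξ | ∃ n ≤ N, l ^ (2 * m) ≤ uSeq h n ξ ^ (2 * m)} := by
    refine measure_mono fun ξ ⟨n, hn, hlt⟩ => ⟨n, hn, ?_⟩
    rw [← (even_two_mul m).pow_abs (uSeq h n ξ)]
    exact pow_le_pow_left₀ hl.le hlt.le _
  refine hmono.trans ?_
  have hl0 : ENNReal.ofReal (l ^ (2 * m)) ≠ 0 := by
    rw [Ne, ENNReal.ofReal_eq_zero, not_le]; positivity
  rw [mul_comm, ← ENNReal.le_div_iff_mul_le (Or.inl hl0) (Or.inl ENNReal.ofReal_ne_top)] at hmax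
  refine hmax.trans ?_
  refine (ENNReal.div_le_div_right (lintegral_uSeq_pow_le hm N h hh hc) _).trans (le_of_eq ?_)
  rw [div_pow, ← pow_mul, ENNReal.ofReal_div_of_pos (by positivity), ← hI, ENNReal.div_eq_inv_mul,
    ENNReal.div_eq_inv_mul, mul_assoc]

end Maximal

/-! ### Restoring degeneracy after truncation -/

section Centering

variable {S : Type*} [MeasurableSpace S] (ν : Measure S) {r : ℕ}

/-- The kernel `h` centred in its coordinate `q`. -/
noncomputable def centering (q : Fin r) (h : (Fin r → S) → ℝ) (s : Fin r → S) : ℝ :=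
  h s - ∫ t, h (Function.update s q t) ∂ν

variable {ν} [IsProbabilityMeasure ν]

theorem measurable_integral_update {h : (Fin r → S) → ℝ} (hh : Measurable h) (q : Fin r) :
    Measurable fun s => ∫ t, h (Function.update s q t) ∂ν := by
  have : StronglyMeasurable fun p : (Fin r → S) × S => h (Function.update p.1 q p.2) :=
    (hh.comp measurable_update').stronglyMeasurable
  exact this.integral_prod_right.measurable

theorem measurable_centering {h : (Fin r → S) → ℝ} (hh : Measurable h) (q : Fin r) :
    Measurable (centering ν q h) :=
  hh.sub (measurable_integral_update hh q)

theorem abs_integral_update_le {h : (Fin r → S) → ℝ} {b : ℝ}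
    (hb : ∀ s, |h s| ≤ b) (q : Fin r) (s : Fin r → S) :
    |∫ t, h (Function.update s q t) ∂ν| ≤ b := by
  have := norm_integral_le_of_norm_le_const (μ := ν) (f := fun t => h (Function.update s q t))
    (C := b) (Filter.Eventually.of_forall fun t => hb _)
  simpa using this

theorem abs_centering_le {h : (Fin r → S) → ℝ} {b : ℝ}
    (hb : ∀ s, |h s| ≤ b) (q : Fin r) (s : Fin r → S) : |centering ν q h s| ≤ 2 * b := by
  have h1 := abs_integral_update_le (ν := ν) hb q s
  have h2 := abs_sub (h s) (∫ t, h (Function.update s q t) ∂ν)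
  rw [centering]
  linarith [hb s]

theorem integrable_update {h : (Fin r → S) → ℝ} (hh : Measurable h) {b : ℝ}
    (hb : ∀ s, |h s| ≤ b) (q : Fin r) (s : Fin r → S) :
    Integrable (fun t => h (Function.update s q t)) ν :=
  Integrable.of_bound (hh.comp (measurable_update s)).aestronglyMeasurable b
    (Filter.Eventually.of_forall fun _ => hb _)

theorem integral_centering_self {h : (Fin r → S) → ℝ} (q : Fin r) (s : Fin r → S)
    (hi : Integrable (fun t => h (Function.update s q t)) ν) :
    ∫ t, centering ν q h (Function.update s q t) ∂ν = 0 := by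
  simp only [centering, Function.update_idem]
  rw [integral_sub hi (integrable_const _)]
  simp

/-- By Fubini, centring one coordinate does not spoil another already centred, so coordinates can be
treated one after the other. -/
theorem integral_centering_of_ne {h : (Fin r → S) → ℝ} (hh : Measurable h) {b : ℝ}
    (hb : ∀ s, |h s| ≤ b) {q j : Fin r} (hjq : j ≠ q)
    (hj : ∀ s, ∫ t, h (Function.update s j t) ∂ν = 0) (s : Fin r → S) :
    ∫ t, centering ν q h (Function.update s j t) ∂ν = 0 := by
  simp only [centering]
  have hm2 : Measurable fun p : S × S => h (Function.update (Function.update s j p.1) q p.2) :=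
    hh.comp (measurable_update'.comp
      (((measurable_update s).comp measurable_fst).prodMk measurable_snd))
  have hi : Integrable (fun t => ∫ t', h (Function.update (Function.update s j t) q t') ∂ν) ν :=
    Integrable.of_bound ((measurable_integral_update hh q).comp
      (measurable_update s)).aestronglyMeasurable b
      (Filter.Eventually.of_forall fun _ => abs_integral_update_le hb q _)
  rw [integral_sub (integrable_update hh hb j s) hi, hj, zero_sub, neg_eq_zero,
    integral_integral_swap]
  · simp only [Function.update_comm hjq, hj, integral_zero]
  · exact Integrable.of_bound hm2.aestronglyMeasurable b
      (Filter.Eventually.of_forall fun _ => hb _)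

theorem lintegral_sub_integral_sq_le {f : S → ℝ} (hf : Measurable f) :
    ∫⁻ t, ENNReal.ofReal ((f t - ∫ u, f u ∂ν) ^ 2) ∂ν ≤ ∫⁻ t, ENNReal.ofReal (f t ^ 2) ∂ν := by
  by_cases h : ∫⁻ t, ENNReal.ofReal (f t ^ 2) ∂ν = ⊤
  · rw [h]; exact le_top
  have hi2 : Integrable (fun t => f t ^ 2) ν :=
    integrable_even_pow_of_lintegral_ne_top (m := 1) hf h
  have hL : MemLp f 2 ν := (memLp_two_iff_integrable_sq hf.aestronglyMeasurable).2 hi2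
  have hi : Integrable f ν := hL.integrable (by norm_num)
  have hi3 : Integrable (fun t => (f t - ∫ u, f u ∂ν) ^ 2) ν :=
    (hL.sub (memLp_const _)).integrable_sq
  rw [← ofReal_integral_eq_lintegral_ofReal hi2 (Filter.Eventually.of_forall fun _ => sq_nonneg _),
    ← ofReal_integral_eq_lintegral_ofReal hi3 (Filter.Eventually.of_forall fun _ => sq_nonneg _)]
  refine ENNReal.ofReal_le_ofReal ?_
  rw [← variance_eq_integral hf.aemeasurable]
  exact variance_le_expectation_sq hf.aestronglyMeasurable

/-- Centering a coordinate is a contraction in `L²`. -/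
theorem lintegral_centering_sq_le {h : (Fin r → S) → ℝ} (hh : Measurable h) (q : Fin r) :
    ∫⁻ ξ, ENNReal.ofReal (centering ν q h (fun k => ξ k) ^ 2) ∂seqLaw ν ≤
      ∫⁻ ξ, ENNReal.ofReal (h (fun k => ξ k) ^ 2) ∂seqLaw ν := by
  rw [lintegral_resample q
      ((measurable_comp_val (measurable_centering hh q)).pow_const _).ennreal_ofReal,
    lintegral_resample q ((measurable_comp_val hh).pow_const _).ennreal_ofReal]
  refine lintegral_mono fun ξ => ?_
  simp only [update_comp_val_fin, centering, Function.update_idem]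
  exact lintegral_sub_integral_sq_le (hh.comp (measurable_update _))

/-- A bounded approximation `f` of a degenerate kernel `h` can be centred in the coordinates of a
finite set without increasing its `L²` distance to `h`. -/
theorem exists_centered_on {h f : (Fin r → S) → ℝ} (hh : Measurable h) (hc : Centered ν h)
    (hf : Measurable f) {b : ℝ} (hb : ∀ s, |f s| ≤ b) (I : Finset (Fin r)) :
    ∃ g : (Fin r → S) → ℝ, Measurable g ∧ (∀ s, |g s| ≤ 2 ^ I.card * b) ∧
      (∀ q ∈ I, ∀ s, ∫ t, g (Function.update s q t) ∂ν = 0) ∧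
      ∫⁻ ξ, ENNReal.ofReal ((h (fun k => ξ k) - g (fun k => ξ k)) ^ 2) ∂seqLaw ν ≤
        ∫⁻ ξ, ENNReal.ofReal ((h (fun k => ξ k) - f (fun k => ξ k)) ^ 2) ∂seqLaw ν := by
  classical
  induction I using Finset.induction_on with
  | empty => exact ⟨f, hf, by simpa using hb, by simp, le_rfl⟩
  | insert q I hq ih =>
    obtain ⟨g, hg, hgb, hgc, hgL⟩ := ih
    refine ⟨centering ν q g, measurable_centering hg q, fun s => ?_, fun j hj s => ?_, ?_⟩
    · rw [Finset.card_insert_of_notMem hq, pow_succ]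
      linarith [abs_centering_le (ν := ν) hgb q s]
    · by_cases hjq : j = q
      · subst hjq
        exact integral_centering_self j s (integrable_update hg hgb j s)
      · exact integral_centering_of_ne hg hgb hjq
          (hgc j ((Finset.mem_insert.1 hj).resolve_left hjq)) s
    -- Centring fixes `h`, which is degenerate, so `h - centering ν q g` is the centring of `h - g`
    -- and the contraction applies.
    · refine le_trans (le_of_eq ?_)
        ((lintegral_centering_sq_le (ν := ν) (hh.sub hg) q).trans hgL)
      refine lintegral_congr fun ξ => ?_
      congr 2
      simp only [centering, Pi.sub_apply]
      rw [integral_sub (hc q _).1 (integrable_update hg hgb q _), (hc q _).2]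
      ring

end Centering

/-! ### Truncation error and the tail integral -/

section Truncation

/-- Truncation of a real number at levels `-b` and `b`. -/
noncomputable def clip (b z : ℝ) : ℝ := max (-b) (min z b)

theorem measurable_clip (b : ℝ) : Measurable (clip b) := by
  unfold clip; fun_prop

theorem clip_mem_Icc {b : ℝ} (hb : 0 ≤ b) (z : ℝ) : clip b z ∈ Set.Icc (-b) b :=
  ⟨le_max_left _ _, max_le (by linarith) (min_le_right _ _)⟩

/-- Outside the window, $(|z|-b)^2\le z^2-b^2$; inside, the left side vanishes. -/
theorem sub_clip_sq_le {b : ℝ} (hb : 0 ≤ b) (z : ℝ) :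
    (z - clip b z) ^ 2 ≤ max (z ^ 2 - b ^ 2) 0 := by
  unfold clip
  rcases le_total z b with h1 | h1
  · rw [min_eq_left h1]
    rcases le_total (-b) z with h2 | h2
    · rw [max_eq_right h2]; simp
    · rw [max_eq_left h2]
      exact le_max_of_le_left (by nlinarith)
  · rw [min_eq_right h1, max_eq_right (by linarith)]
    exact le_max_of_le_left (by nlinarith)

variable {Ω : Type*} [MeasurableSpace Ω] {μ : Measure Ω}

/-- Layer-cake formula for $(f^2/b^2-1)_+$. Shifting the variable by one makes the integral start at
$1$, as in the final bound. -/
theorem lintegral_max_sq_sub {f : Ω → ℝ} (hf : Measurable f) {b : ℝ} (hb : 0 < b) :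
    ∫⁻ ω, ENNReal.ofReal (max (f ω ^ 2 - b ^ 2) 0) ∂μ =
      ENNReal.ofReal (b ^ 2) *
        ∫⁻ u in Set.Ioi (1 : ℝ), μ {ω | b * u ^ ((1 : ℝ) / 2) < |f ω|} := by
  have e1 : ∀ ω, ENNReal.ofReal (max (f ω ^ 2 - b ^ 2) 0) =
      ENNReal.ofReal (b ^ 2) * ENNReal.ofReal (max (f ω ^ 2 / b ^ 2 - 1) 0) := by
    intro ω
    rw [← ENNReal.ofReal_mul (sq_nonneg b), mul_max_of_nonneg _ _ (sq_nonneg b), mul_zero]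
    congr 2
    field_simp
  simp only [e1]
  rw [lintegral_const_mul _ (by fun_prop), lintegral_eq_lintegral_meas_lt μ
    (f := fun ω => max (f ω ^ 2 / b ^ 2 - 1) 0)
    (Filter.Eventually.of_forall fun ω => le_max_right _ _) (by fun_prop)]
  congr 1
  have e2 : ∫⁻ u in Set.Ioi (1 : ℝ), μ {ω | b * u ^ ((1 : ℝ) / 2) < |f ω|} =
      ∫⁻ t in Set.Ioi (0 : ℝ), μ {ω | b * (t + 1) ^ ((1 : ℝ) / 2) < |f ω|} := by
    rw [← lintegral_indicator measurableSet_Ioi, ← lintegral_indicator measurableSet_Ioi,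
      ← lintegral_add_right_eq_self _ (1 : ℝ)]
    refine lintegral_congr fun t => ?_
    by_cases ht : 0 < t
    · rw [Set.indicator_of_mem (Set.mem_Ioi.2 ht),
        Set.indicator_of_mem (Set.mem_Ioi.2 (by linarith))]
    · rw [Set.indicator_of_notMem (by simpa using ht), Set.indicator_of_notMem (by simpa using ht)]
  rw [e2]
  refine setLIntegral_congr_fun measurableSet_Ioi fun t ht => ?_
  have ht0 : (0 : ℝ) < t := ht
  congr 1
  ext ω
  simp only [Set.mem_ofPred_eq, lt_max_iff, not_lt.2 ht0.le, or_false]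
  rw [lt_sub_iff_add_lt, lt_div_iff₀ (by positivity), ← Real.sqrt_eq_rpow,
    ← abs_of_nonneg (by positivity : 0 ≤ b * √(t + 1)), ← sq_lt_sq, mul_pow,
    Real.sq_sqrt (by positivity), mul_comm]

end Truncation

/-! ### Numerical constants and the choice of exponent -/

section Constants

theorem kappa_pos {q : ℝ} : 0 < kappa q := by
  unfold kappa
  split_ifs with h
  · exact one_pos
  · have : 0 < q := by linarith
    positivity

theorem kappa_eq {q : ℝ} (hq : 1 ≤ q) : kappa q = Real.exp (q - 1 - q * Real.log q) := by
  have hq0 : 0 < q := by linarith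
  unfold kappa
  split_ifs with h
  · obtain rfl : q = 1 := le_antisymm h hq
    simp
  · rw [Real.exp_sub (q - 1), mul_comm q, ← Real.rpow_def_of_pos hq0]

theorem kappa_le_one (q : ℝ) : kappa q ≤ 1 := by
  rcases le_or_gt q 1 with h | h
  · simp [kappa, h]
  · have hq0 : 0 < q := by linarith
    rw [kappa_eq h.le, Real.exp_le_one_iff]
    have h1 := mul_le_mul_of_nonneg_left (Real.one_sub_inv_le_log_of_pos hq0) hq0.le
    rw [mul_sub, mul_inv_cancel₀ hq0.ne'] at h1
    linarith

theorem kappa_two_mul_le {q : ℝ} (hq : 1 ≤ q) : kappa (2 * q) ≤ kappa q := by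
  have hq0 : 0 < q := by linarith
  rw [kappa_eq hq, kappa_eq (by linarith), Real.exp_le_exp,
    Real.log_mul (by norm_num) hq0.ne']
  have h1 : 0 ≤ Real.log q := Real.log_nonneg hq
  -- All that matters is $2\ln 2\ge 1$.
  have h2 := Real.log_two_gt_d9
  nlinarith

theorem kappa_two_mul_natCast_le (i : ℕ) : kappa (2 * (i : ℝ)) ≤ kappa i := by
  rcases Nat.eq_zero_or_pos i with rfl | h
  · simp
  · exact kappa_two_mul_le (by exact_mod_cast h)

theorem constC_pos (r : ℕ) : 0 < constC r :=
  mul_pos (by positivity) (Finset.prod_pos fun _ _ => Real.rpow_pos_of_pos kappa_pos _)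

theorem four_rpow_neg_half (r : ℕ) : (4 : ℝ) ^ (-(r : ℝ) / 2) = ((2 : ℝ) ^ r)⁻¹ := by
  rw [show (4 : ℝ) = 2 ^ (2 : ℝ) by norm_num, ← Real.rpow_mul (by norm_num),
    mul_div_cancel₀ _ (two_ne_zero), Real.rpow_neg (by norm_num), Real.rpow_natCast]

/-- Each centring at most doubles the bound on the kernel, so one truncated at `y * constC r` is
still bounded by `y` after all `r` of them. -/
theorem two_pow_mul_constC_le (r : ℕ) : 2 ^ r * constC r ≤ 1 := by
  rw [constC, four_rpow_neg_half, ← mul_assoc, mul_inv_cancel₀ (by positivity), one_mul]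
  exact Finset.prod_le_one (fun _ _ => Real.rpow_nonneg kappa_pos.le _)
    fun i _ => Real.rpow_le_one kappa_pos.le (kappa_le_one _) (by norm_num)

theorem constC_sq (r : ℕ) : constC r ^ 2 = ((4 : ℝ) ^ r)⁻¹ * ∏ i ∈ Finset.range r, kappa i := by
  rw [constC, four_rpow_neg_half, mul_pow, ← Finset.prod_pow]
  congr 1
  · rw [inv_pow, ← pow_mul, mul_comm, pow_mul]; norm_num
  · refine Finset.prod_congr rfl fun i _ => ?_
    rw [← Real.sqrt_eq_rpow, Real.sq_sqrt kappa_pos.le]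

/-- The other factors of $B_r$ are at least one, the logarithms being nonnegative by
`kappa_two_mul_natCast_le`. -/
theorem prod_kappa_le_constB (r : ℕ) : ∏ i ∈ Finset.range r, kappa i ≤ constB r := by
  have h0 : 0 ≤ ∏ i ∈ Finset.range r, kappa i := Finset.prod_nonneg fun _ _ => kappa_pos.le
  have h1 : ∏ i ∈ Finset.range r, kappa i ≤ ∏ i ∈ Finset.range r,
      ((2 : ℝ) ^ i * kappa i) * (1 + Real.log (kappa i / kappa (2 * i))) ^ i := by
    refine Finset.prod_le_prod (fun _ _ => kappa_pos.le) fun i _ => ?_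
    have hk : (0 : ℝ) < kappa i := kappa_pos
    have h2 : (1 : ℝ) ≤ 2 ^ i := one_le_pow₀ (by norm_num)
    have h3 : 0 ≤ Real.log (kappa i / kappa (2 * i)) :=
      Real.log_nonneg ((one_le_div kappa_pos).2 (kappa_two_mul_natCast_le i))
    have h4 : 1 ≤ (1 + Real.log (kappa i / kappa (2 * i))) ^ i := one_le_pow₀ (by linarith)
    calc kappa i = 1 * kappa i * 1 := by ring
      _ ≤ _ := by gcongr
  unfold constB
  linarith

theorem two_le_constA {r : ℕ} (hr : 1 ≤ r) : 2 ≤ constA r := by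
  have : (2 : ℝ) ^ (-(r : ℝ)) ≤ 1 / 2 := by
    rw [Real.rpow_neg (by norm_num), Real.rpow_natCast, ← one_div]
    have : (2 : ℝ) ^ 1 ≤ 2 ^ r := pow_le_pow_right₀ (by norm_num) hr
    gcongr
    simpa using this
  unfold constA
  linarith

theorem three_pow_lt_sq_div {r : ℕ} {x y : ℝ} (hxy : 3 ^ r < x / y) : 9 ^ r < (x / y) ^ 2 := by
  have : (9 : ℝ) ^ r = (3 ^ r) ^ 2 := by rw [← pow_mul, mul_comm, pow_mul]; norm_num
  rw [this]
  exact pow_lt_pow_left₀ hxy (by positivity) (by norm_num)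

/-- This quotient comes from the second-moment bound for `h - g` at a fraction `δ` of the level. The
factor $36^r$ is $9^r$, from $x/y>3^r$, times $4^r$, from $C_r^{-2}$. -/
theorem tail_coefficient_le {r : ℕ} {x y δ : ℝ} (hx : 0 < x) (hy : 0 < y) (hδ : 0 < δ)
    (hxy : 3 ^ r < x / y) (h : 1 ≤ r.factorial * δ ^ 2 * 36 ^ r) :
    (y * constC r) ^ 2 / (r.factorial * δ ^ 2 * x ^ 2) ≤ constB r := by
  refine le_trans ?_ (prod_kappa_le_constB r)
  have hP : 0 ≤ ∏ i ∈ Finset.range r, kappa i := Finset.prod_nonneg fun _ _ => kappa_pos.le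
  have h9 := three_pow_lt_sq_div hxy
  rw [div_pow, lt_div_iff₀ (by positivity)] at h9
  rw [mul_pow, constC_sq, div_le_iff₀ (by positivity)]
  have hcoef : y ^ 2 * ((4 : ℝ) ^ r)⁻¹ ≤ r.factorial * δ ^ 2 * x ^ 2 := by
    rw [← div_eq_mul_inv, div_le_iff₀ (by positivity)]
    have e : (36 : ℝ) ^ r = 9 ^ r * 4 ^ r := by rw [← mul_pow]; norm_num
    rw [e] at h
    calc y ^ 2 = 1 * y ^ 2 := by ring
      _ ≤ r.factorial * δ ^ 2 * (9 ^ r * 4 ^ r) * y ^ 2 := by gcongr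
      _ = r.factorial * δ ^ 2 * (9 ^ r * y ^ 2) * 4 ^ r := by ring
      _ ≤ _ := by gcongr
  calc y ^ 2 * (((4 : ℝ) ^ r)⁻¹ * ∏ i ∈ Finset.range r, kappa i)
      = (∏ i ∈ Finset.range r, kappa i) * (y ^ 2 * ((4 : ℝ) ^ r)⁻¹) := by ring
    _ ≤ _ := by gcongr

theorem exp_one_div_two_pow_le_factorial {r : ℕ} (hr : 2 ≤ r) :
    (Real.exp 1 / 2) ^ r ≤ r.factorial * (39 / 40) ^ 2 := by
  have he := Real.exp_one_lt_d9
  have he0 := Real.exp_pos 1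
  induction r, hr using Nat.le_induction with
  -- The tight case, which limits how much of the level can be given away: $(e/2)^2\approx1.848$
  -- against $2(39/40)^2\approx1.901$.
  | base =>
    norm_num [Nat.factorial]
    nlinarith
  | succ r hr ih =>
    have hr' : (2 : ℝ) ≤ r := by exact_mod_cast hr
    have hle : Real.exp 1 / 2 ≤ r + 1 := by linarith
    rw [pow_succ, Nat.factorial_succ]
    push_cast
    calc (Real.exp 1 / 2) ^ r * (Real.exp 1 / 2)
        ≤ (r.factorial * (39 / 40) ^ 2) * (r + 1) := by gcongr
      _ = _ := by ring

/-- The optimal even exponent in Markov's inequality. -/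
theorem exists_even_exponent {T : ℝ} (hT : 9 ≤ T) {r : ℕ} (hr : 2 ≤ r) :
    ∃ m : ℕ, 1 ≤ m ∧
      ((2 * (2 * m - 1) / (Real.exp 1 * T)) ^ r) ^ m ≤ Real.exp (-(1 / 2) * T) := by
  set θ : ℝ := T / 2 with hθ
  have hθ0 : 2 < θ := by rw [hθ]; linarith
  have hθp : 0 < θ := by linarith
  -- Thus `2 * m - 1` is the largest odd integer not exceeding `θ`, and `d < 2` measures the
  -- rounding.
  set m : ℕ := ⌊(θ + 1) / 2⌋₊ with hm
  have hm1 : 1 ≤ m := Nat.le_floor (by push_cast; linarith)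
  have hm1' : (1 : ℝ) ≤ m := by exact_mod_cast hm1
  have hle : (m : ℝ) ≤ (θ + 1) / 2 := Nat.floor_le (by linarith)
  have hlt : (θ + 1) / 2 < m + 1 := Nat.lt_floor_add_one _
  refine ⟨m, hm1, ?_⟩
  set d : ℝ := θ - (2 * m - 1) with hd
  have hd0 : 0 ≤ d := by rw [hd]; linarith
  have hd2 : d < 2 := by rw [hd]; linarith
  have hbase : 2 * (2 * m - 1) / (Real.exp 1 * T) ≤ Real.exp (-(1 + d / θ)) := by
    have e1 : 2 * (2 * (m : ℝ) - 1) / (Real.exp 1 * T) = (-(d / θ) + 1) * (Real.exp 1)⁻¹ := by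
      have : T = 2 * θ := by rw [hθ]; ring
      rw [this]
      field_simp
      rw [hd]; ring
    rw [e1, show -(1 + d / θ) = -(d / θ) + -1 by ring, Real.exp_add, Real.exp_neg 1]
    gcongr
    exact Real.add_one_le_exp _
  have hb0 : 0 ≤ 2 * (2 * (m : ℝ) - 1) / (Real.exp 1 * T) := by
    have : 0 < 2 * (m : ℝ) - 1 := by linarith
    positivity
  rw [← pow_mul]
  refine (pow_le_pow_left₀ hb0 hbase _).trans ?_
  rw [← Real.exp_nat_mul, Real.exp_le_exp]
  -- Equivalent to $\theta+d-d^2\ge0$, which holds since $d<2<\theta$. The factor `2 * m` is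
  -- available because the order is at least two.
  have h2 : θ ≤ 2 * m * (1 + d / θ) := by
    have e2 : 2 * (m : ℝ) = θ - d + 1 := by rw [hd]; ring
    rw [e2, one_add_div hθp.ne', ← mul_div_assoc, le_div_iff₀ hθp]
    nlinarith
  have h3 : 2 * (m : ℝ) * (1 + d / θ) ≤ ((r * m : ℕ) : ℝ) * (1 + d / θ) := by
    have : (2 : ℝ) ≤ r := by exact_mod_cast hr
    push_cast
    gcongr
  have : T = 2 * θ := by rw [hθ]; ring
  rw [this]
  linarith

end Constants

/-! ### Tail bounds for the two pieces and their combination -/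

section Assembly

variable {S : Type*} [MeasurableSpace S] {ν : Measure S} [IsProbabilityMeasure ν] {r : ℕ}

theorem rpow_half_sq (N r : ℕ) : ((N : ℝ) ^ ((r : ℝ) / 2)) ^ 2 = (N : ℝ) ^ r := by
  rw [← Real.rpow_natCast, ← Real.rpow_mul (Nat.cast_nonneg N), ← Real.rpow_natCast]
  congr 1
  push_cast
  ring

/-- Since $\binom Nr\le N^r/r!$ and the squared level carries $N^r$, the sample size cancels. -/
theorem choose_div_sq_le {N r : ℕ} (hN : 1 ≤ N) {x δ : ℝ} (hx : 0 < x) (hδ : 0 < δ) :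
    (N.choose r : ℝ) / (δ * ((N : ℝ) ^ ((r : ℝ) / 2) * x)) ^ 2 ≤
      1 / (r.factorial * δ ^ 2 * x ^ 2) := by
  have hN0 : (0 : ℝ) < N := by exact_mod_cast hN
  have h := Nat.choose_le_pow_div (α := ℝ) r N
  rw [le_div_iff₀ (by positivity)] at h
  rw [mul_pow, mul_pow, rpow_half_sq, div_le_div_iff₀ (by positivity) (by positivity)]
  calc (N.choose r : ℝ) * (r.factorial * δ ^ 2 * x ^ 2)
      = (N.choose r * r.factorial) * (δ ^ 2 * x ^ 2) := by ring
    _ ≤ (N : ℝ) ^ r * (δ ^ 2 * x ^ 2) := by gcongr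
    _ = _ := by ring

/-- Tail bound for a bounded completely degenerate kernel of order at least two. -/
theorem measure_exists_lt_abs_le_of_bounded {g : (Fin (r + 1) → S) → ℝ} (hg : Measurable g)
    (hc : Centered ν g) (hr : 1 ≤ r) {N : ℕ} (hN : r + 1 ≤ N) {x y : ℝ} (hx : 0 < x) (hy : 0 < y)
    (hxy : 3 ^ (r + 1) < x / y) (hgy : ∀ s, |g s| ≤ y) :
    seqLaw ν {ξ | ∃ n ≤ N, 39 / 40 * ((N : ℝ) ^ (((r + 1 : ℕ) : ℝ) / 2) * x) < |uSeq g n ξ|} ≤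
      ENNReal.ofReal (Real.exp (-(1 / 2) * (x / y) ^ ((2 : ℝ) / (r + 1 : ℕ)))) := by
  set T : ℝ := (x / y) ^ ((2 : ℝ) / (r + 1 : ℕ)) with hT
  have hxy0 : 0 < x / y := div_pos hx hy
  have hTr : T ^ (r + 1) = (x / y) ^ 2 := by
    rw [hT, ← Real.rpow_natCast, ← Real.rpow_mul hxy0.le, div_mul_cancel₀ _ (by positivity)]
    norm_cast
  have hT9 : 9 ≤ T := by
    have h9 := three_pow_lt_sq_div hxy
    rw [← hTr] at h9
    exact (lt_of_pow_lt_pow_left₀ _ (by positivity) h9).le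
  have hT0 : 0 < T := by linarith
  obtain ⟨m, hm, hmT⟩ := exists_even_exponent hT9 (r := r + 1) (by omega)
  have hm1 : (1 : ℝ) ≤ m := by exact_mod_cast hm
  have hm2 : (0 : ℝ) < 2 * m - 1 := by linarith
  have hN0 : (0 : ℝ) < N := by exact_mod_cast (by omega : 0 < N)
  refine (measure_exists_lt_abs_le hg hc hm hN (by positivity)).trans ?_
  have hI : ∫⁻ ξ, ENNReal.ofReal (g (fun k => ξ k) ^ (2 * m)) ∂seqLaw ν ≤
      ENNReal.ofReal ((y ^ 2) ^ m) := by
    calc _ ≤ ∫⁻ _, ENNReal.ofReal ((y ^ 2) ^ m) ∂seqLaw ν := by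
          refine lintegral_mono fun ξ => ENNReal.ofReal_le_ofReal ?_
          rw [← (even_two_mul m).pow_abs, ← pow_mul]
          exact pow_le_pow_left₀ (abs_nonneg _) (hgy _) _
      _ = _ := by simp
  refine (mul_le_mul_right hI _).trans ?_
  rw [← ENNReal.ofReal_mul (by positivity), ← mul_pow]
  refine ENNReal.ofReal_le_ofReal (le_trans ?_ hmT)
  refine pow_le_pow_left₀ (by positivity) ?_ _
  have h1 := choose_div_sq_le (r := r + 1) (N := N) (by omega) hx (by norm_num : (0 : ℝ) < 39 / 40)
  have h2 := exp_one_div_two_pow_le_factorial (r := r + 1) (by omega)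
  have hx2 : x ^ 2 = T ^ (r + 1) * y ^ 2 := by rw [hTr]; field_simp
  calc _ = (2 * (m : ℝ) - 1) ^ (r + 1) * y ^ 2 *
        (N.choose (r + 1) / (39 / 40 * ((N : ℝ) ^ (((r + 1 : ℕ) : ℝ) / 2) * x)) ^ 2) := by ring
    _ ≤ (2 * (m : ℝ) - 1) ^ (r + 1) * y ^ 2 *
        (1 / ((r + 1).factorial * (39 / 40) ^ 2 * x ^ 2)) := by gcongr
    _ = (2 * (m : ℝ) - 1) ^ (r + 1) / T ^ (r + 1) *
        (1 / ((r + 1).factorial * (39 / 40) ^ 2)) := by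
          rw [hx2]; field_simp
    _ ≤ (2 * (m : ℝ) - 1) ^ (r + 1) / T ^ (r + 1) * (1 / (Real.exp 1 / 2) ^ (r + 1)) := by gcongr
    _ = _ := by
          rw [div_mul_div_comm, mul_one, ← mul_pow, ← div_pow]
          congr 1
          field_simp

/-- Integrating out the newest datum costs a factor at most $e^c$. -/
theorem integral_exp_uSeq_one_le {g : (Fin 1 → S) → ℝ} (hg : Measurable g) {b c t : ℝ}
    (hb : ∀ s, |g s| ≤ b) (hc : ∫ s, Real.exp (t * g fun _ => s) ∂ν ≤ Real.exp c) (n : ℕ) :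
    ∫ ξ, Real.exp (t * uSeq g n ξ) ∂seqLaw ν ≤ Real.exp (n * c) := by
  have hint : ∀ n, Integrable (fun ξ => Real.exp (t * uSeq g n ξ)) (seqLaw ν) := by
    intro n
    refine Integrable.of_bound (by have := measurable_uSeq hg n; fun_prop)
      (Real.exp (|t| * (n * b))) (Filter.Eventually.of_forall fun ξ => ?_)
    rw [Real.norm_eq_abs, Real.abs_exp, Real.exp_le_exp]
    refine (le_abs_self _).trans ?_
    rw [abs_mul]
    gcongr
    exact abs_uSeq_one_le hb n ξ
  induction n with
  | zero => simp [uSeq_eq_zero_of_lt g one_pos]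
  | succ n ih =>
    rw [integral_resample n (hint _)]
    simp only [uSeq_one_succ, uSeq_update g le_rfl, Function.update_self, mul_add, Real.exp_add,
      integral_const_mul, integral_mul_const]
    calc _ ≤ Real.exp (n * c) * Real.exp c := by gcongr
      _ = _ := by rw [← Real.exp_add]; congr 1; push_cast; ring

theorem measure_exists_lt_uSeq_one_le {g : (Fin 1 → S) → ℝ} (hg : Measurable g)
    (hcen : Centered ν g) {b c t l : ℝ} (hb : ∀ s, |g s| ≤ b)
    (hc : ∫ s, Real.exp (t * g fun _ => s) ∂ν ≤ Real.exp c) (N : ℕ) :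
    seqLaw ν {ξ | ∃ n ≤ N, l ≤ t * uSeq g n ξ} ≤ ENNReal.ofReal (Real.exp (N * c - l)) := by
  have hbound : ∀ n ξ, Real.exp (t * uSeq g n ξ) ≤ Real.exp (|t| * (n * b)) := by
    intro n ξ
    rw [Real.exp_le_exp]
    refine (le_abs_self _).trans ?_
    rw [abs_mul]
    gcongr
    exact abs_uSeq_one_le hb n ξ
  have hmax := measure_exists_le_le_integral hg hcen (φ := fun a => Real.exp (t * a))
    (ψ := fun a => t * Real.exp (t * a)) (by fun_prop) (fun a => (Real.exp_pos _).le) ?_ ?_ ?_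
    (Real.exp_pos l).le N
  · have h0 : ENNReal.ofReal (Real.exp l) ≠ 0 := by
      rw [Ne, ENNReal.ofReal_eq_zero, not_le]; positivity
    simp only [Real.exp_le_exp] at hmax
    rw [mul_comm, ← ENNReal.le_div_iff_mul_le (Or.inl h0) (Or.inl ENNReal.ofReal_ne_top),
      ← ENNReal.ofReal_div_of_pos (Real.exp_pos l)] at hmax
    refine hmax.trans (ENNReal.ofReal_le_ofReal ?_)
    rw [Real.exp_sub]
    gcongr
    exact integral_exp_uSeq_one_le hg hb hc N
  · intro a b
    have h1 := mul_le_mul_of_nonneg_left (Real.add_one_le_exp (t * b)) (Real.exp_pos (t * a)).le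
    rw [mul_add t a b, Real.exp_add]
    linarith
  · intro n
    refine Integrable.of_bound (by have := measurable_uSeq hg n; fun_prop)
      (Real.exp (|t| * (n * b))) (Filter.Eventually.of_forall fun ξ => ?_)
    rw [Real.norm_eq_abs, Real.abs_exp]
    exact hbound n ξ
  · intro n
    have hm := measurable_uSeq hg n
    have hm' := measurable_uSeq_snoc_diag hg n
    refine Integrable.of_bound (by fun_prop) (|t| * Real.exp (|t| * (n * b)) * b)
      (Filter.Eventually.of_forall fun ξ => ?_)
    rw [Real.norm_eq_abs, abs_mul, abs_mul, Real.abs_exp, uSeq_order_zero]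
    exact mul_le_mul (mul_le_mul_of_nonneg_left (hbound n ξ) (abs_nonneg t)) (hb _)
      (abs_nonneg _) (by positivity)

/-- Maximal form of Hoeffding's inequality. -/
theorem measure_exists_lt_abs_uSeq_one_le {g : (Fin 1 → S) → ℝ} (hg : Measurable g)
    (hcen : Centered ν g) {a b l : ℝ} (hb : 0 < b) (hl : 0 ≤ l)
    (hab : ∀ s, g s ∈ Set.Icc (a - b) (a + b)) {N : ℕ} (hN : 1 ≤ N) :
    seqLaw ν {ξ | ∃ n ≤ N, l < |uSeq g n ξ|} ≤
      ENNReal.ofReal (2 * Real.exp (-(l ^ 2 / (2 * N * b ^ 2)))) := by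
  have hN0 : (0 : ℝ) < N := by exact_mod_cast hN
  have hupd : ∀ (s₀ : Fin 1 → S) (s : S), Function.update s₀ 0 s = fun _ => s := by
    intro s₀ s
    funext k
    rw [Subsingleton.elim k 0, Function.update_self]
  have hgm : Measurable fun s : S => g fun _ => s :=
    hg.comp (measurable_pi_lambda _ fun _ => measurable_id)
  have hmean : ∫ s, g (fun _ => s) ∂ν = 0 := by
    obtain ⟨s₀⟩ := nonempty_of_isProbabilityMeasure ν
    have := (hcen 0 fun _ => s₀).2
    simpa only [hupd] using this
  have hsub := hasSubgaussianMGF_of_mem_Icc_of_integral_eq_zero hgm.aemeasurable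
    (Filter.Eventually.of_forall fun s => hab fun _ => s) hmean
  have hmgf : ∀ t, ∫ s, Real.exp (t * g fun _ => s) ∂ν ≤ Real.exp (b ^ 2 * t ^ 2 / 2) := by
    intro t
    have := hsub.mgf_le t
    have e : ((((‖a + b - (a - b)‖₊ / 2) ^ 2 : NNReal)) : ℝ) = b ^ 2 := by
      push_cast
      rw [Real.norm_eq_abs, show a + b - (a - b) = 2 * b by ring, abs_of_pos (by linarith)]
      ring
    rwa [e] at this
  have habs : ∀ s, |g s| ≤ |a| + b := by
    intro s
    have h1 := (hab s).1
    have h2 := (hab s).2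
    rw [abs_le]
    constructor <;> linarith [le_abs_self a, neg_abs_le a]
  -- The minimiser of $Nb^2t^2/2-tl$.
  set t : ℝ := l / (N * b ^ 2) with ht
  have ht0 : 0 ≤ t := by positivity
  have hexp : (N : ℝ) * (b ^ 2 * t ^ 2 / 2) - t * l = -(l ^ 2 / (2 * N * b ^ 2)) := by
    rw [ht]; field_simp; ring
  have h1 := measure_exists_lt_uSeq_one_le (l := t * l) hg hcen habs (hmgf t) N
  have h2 := measure_exists_lt_uSeq_one_le (l := t * l) hg hcen habs (hmgf (-t)) N
  rw [hexp] at h1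
  rw [neg_sq, hexp] at h2
  calc _ ≤ seqLaw ν ({ξ | ∃ n ≤ N, t * l ≤ t * uSeq g n ξ} ∪
        {ξ | ∃ n ≤ N, t * l ≤ -t * uSeq g n ξ}) := by
        refine measure_mono fun ξ ⟨n, hn, hlt⟩ => ?_
        rcases lt_abs.1 hlt with h | h
        · exact Or.inl ⟨n, hn, mul_le_mul_of_nonneg_left h.le ht0⟩
        · refine Or.inr ⟨n, hn, ?_⟩
          rw [neg_mul, ← mul_neg]
          exact mul_le_mul_of_nonneg_left h.le ht0
    _ ≤ _ := (measure_union_le _ _).trans (add_le_add h1 h2)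
    _ = _ := by rw [← ENNReal.ofReal_add (by positivity) (by positivity), ← two_mul]

/-- A tail bound for a `U`-statistic with a degenerate kernel `h` out of one for a degenerate
kernel `g` close to `h` in `L²`. -/
theorem measure_exists_lt_abs_le_add {h g : (Fin (r + 1) → S) → ℝ} (hh : Measurable h)
    (hhc : Centered ν h) (hg : Measurable g) (hgc : Centered ν g) {N : ℕ} (hN : r + 1 ≤ N)
    {x y δ : ℝ} (hx : 0 < x) (hy : 0 < y) (hδ : 0 < δ) (hxy : 3 ^ (r + 1) < x / y)
    (hδr : 1 ≤ (r + 1).factorial * δ ^ 2 * 36 ^ (r + 1))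
    (hL : ∫⁻ ξ, ENNReal.ofReal ((h (fun k => ξ k) - g (fun k => ξ k)) ^ 2) ∂seqLaw ν ≤
      ∫⁻ ξ, ENNReal.ofReal ((h (fun k => ξ k) -
        clip (y * constC (r + 1)) (h (fun k => ξ k))) ^ 2) ∂seqLaw ν) :
    seqLaw ν {ξ | ∃ n ≤ N, (N : ℝ) ^ (((r + 1 : ℕ) : ℝ) / 2) * x < |uSeq h n ξ|} ≤
      seqLaw ν {ξ | ∃ n ≤ N,
        (1 - δ) * ((N : ℝ) ^ (((r + 1 : ℕ) : ℝ) / 2) * x) < |uSeq g n ξ|} +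
      ENNReal.ofReal (constB (r + 1)) * ∫⁻ u in Set.Ioi (1 : ℝ),
        seqLaw ν {ξ | y * constC (r + 1) * u ^ ((1 : ℝ) / 2) < |h fun k => ξ k|} := by
  have hN0 : (0 : ℝ) < N := by exact_mod_cast (by omega : 0 < N)
  have hb : 0 < y * constC (r + 1) := mul_pos hy (constC_pos _)
  set l : ℝ := (N : ℝ) ^ (((r + 1 : ℕ) : ℝ) / 2) * x with hl
  have hl0 : 0 < l := by positivity
  have hdc : Centered ν fun s => h s - g s := by
    intro q s
    refine ⟨(hhc q s).1.sub (hgc q s).1, ?_⟩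
    rw [integral_sub (hhc q s).1 (hgc q s).1, (hhc q s).2, (hgc q s).2, sub_zero]
  have hsplit : ∀ n ξ, uSeq h n ξ = uSeq g n ξ + uSeq (fun s => h s - g s) n ξ := by
    intro n ξ
    rw [← uSeq_add]
    simp
  have hunion : seqLaw ν {ξ | ∃ n ≤ N, l < |uSeq h n ξ|} ≤
      seqLaw ν ({ξ | ∃ n ≤ N, (1 - δ) * l < |uSeq g n ξ|} ∪
        {ξ | ∃ n ≤ N, δ * l < |uSeq (fun s => h s - g s) n ξ|}) := by
    refine measure_mono fun ξ ⟨n, hn, hlt⟩ => ?_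
    by_cases h1 : (1 - δ) * l < |uSeq g n ξ|
    · exact Or.inl ⟨n, hn, h1⟩
    · refine Or.inr ⟨n, hn, ?_⟩
      rw [hsplit] at hlt
      linarith [abs_add_le (uSeq g n ξ) (uSeq (fun s => h s - g s) n ξ)]
  refine hunion.trans ((measure_union_le _ _).trans (add_le_add le_rfl ?_))
  -- Only second moments (`m = 1`) are used for the unbounded remainder.
  have hcheb := measure_exists_lt_abs_le (hh.sub hg) hdc le_rfl hN (mul_pos hδ hl0)
  refine hcheb.trans ?_
  have hL' : ∫⁻ ξ, ENNReal.ofReal ((h (fun k => ξ k) - g (fun k => ξ k)) ^ (2 * 1)) ∂seqLaw ν ≤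
      ENNReal.ofReal ((y * constC (r + 1)) ^ 2) * ∫⁻ u in Set.Ioi (1 : ℝ),
        seqLaw ν {ξ | y * constC (r + 1) * u ^ ((1 : ℝ) / 2) < |h fun k => ξ k|} := by
    refine hL.trans ?_
    rw [← lintegral_max_sq_sub (measurable_comp_val hh) hb]
    exact lintegral_mono fun ξ => ENNReal.ofReal_le_ofReal (sub_clip_sq_le hb.le _)
  refine (mul_le_mul_right hL' _).trans ?_
  rw [← mul_assoc, ← ENNReal.ofReal_mul (by positivity)]
  refine mul_le_mul_left (ENNReal.ofReal_le_ofReal ?_) _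
  refine le_trans ?_ (tail_coefficient_le hx hy hδ hxy hδr)
  have h1 := choose_div_sq_le (r := r + 1) (N := N) (by omega) hx hδ
  rw [← hl] at h1
  have e : (2 * ((1 : ℕ) : ℝ) - 1) ^ (r + 1) = 1 := by norm_num
  rw [e, one_mul, pow_one, div_eq_mul_one_div ((y * constC (r + 1)) ^ 2), mul_comm]
  gcongr

/-- The exponential inequality without the logarithmic weight. -/
theorem measure_exists_lt_abs_uSeq_le {h : (Fin (r + 1) → S) → ℝ} (hh : Measurable h)
    (hc : Centered ν h) {N : ℕ} (hN : r + 1 ≤ N) {x y : ℝ} (hx : 0 < x) (hy : 0 < y)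
    (hxy : 3 ^ (r + 1) < x / y) :
    seqLaw ν {ξ | ∃ n ≤ N, (N : ℝ) ^ (((r + 1 : ℕ) : ℝ) / 2) * x < |uSeq h n ξ|} ≤
      ENNReal.ofReal (2 * Real.exp (-(1 / 2) * (x / y) ^ ((2 : ℝ) / (r + 1 : ℕ)))) +
      ENNReal.ofReal (constB (r + 1)) * ∫⁻ u in Set.Ioi (1 : ℝ),
        seqLaw ν {ξ | y * constC (r + 1) * u ^ ((1 : ℝ) / 2) < |h fun k => ξ k|} := by
  have hN0 : (0 : ℝ) < N := by exact_mod_cast (by omega : 0 < N)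
  set b : ℝ := y * constC (r + 1) with hb
  have hb0 : 0 < b := mul_pos hy (constC_pos _)
  have hfm : Measurable fun s => clip b (h s) := (measurable_clip b).comp hh
  have hfb : ∀ s, |clip b (h s)| ≤ b := fun s => abs_le.2 (clip_mem_Icc hb0.le _)
  rcases Nat.eq_zero_or_pos r with rfl | hr
  · have : Subsingleton (Fin (0 + 1)) := inferInstanceAs (Subsingleton (Fin 1))
    have hby : b = y / 2 := by
      rw [hb]
      rw [constC, four_rpow_neg_half]
      simp [kappa]
      ring
    set g := centering ν 0 fun s => clip b (h s) with hg
    have hgm : Measurable g := measurable_centering hfm 0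
    obtain ⟨s₀⟩ := nonempty_of_isProbabilityMeasure ν
    -- With a single coordinate, centring subtracts a constant: the range stays in an interval of
    -- length `2 * b = y`, and Hoeffding at half the level gives exactly $-\frac12(x/y)^2$.
    set a : ℝ := ∫ t, clip b (h (Function.update (fun _ => s₀) 0 t)) ∂ν with ha
    have hga : ∀ s, g s = clip b (h s) - a := by
      intro s
      rw [hg, centering, ha]
      congr 3
      funext t
      congr 2
      funext k
      rw [Subsingleton.elim k 0, Function.update_self, Function.update_self]
    have hgc : Centered ν g := by
      intro q s
      rw [Subsingleton.elim q 0]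
      exact ⟨integrable_update hgm (abs_centering_le hfb 0) 0 s,
        integral_centering_self 0 s (integrable_update hfm hfb 0 s)⟩
    refine (measure_exists_lt_abs_le_add hh hc hgm hgc hN hx hy (by norm_num : (0 : ℝ) < 1 / 2)
      hxy (by norm_num) ?_).trans (add_le_add ?_ le_rfl)
    · refine le_trans (le_of_eq (lintegral_congr fun ξ => ?_))
        (lintegral_centering_sq_le (ν := ν) (hh.sub hfm) 0)
      congr 2
      simp only [hg, centering, Pi.sub_apply]
      rw [integral_sub (hc 0 _).1 (integrable_update hfm hfb 0 _), (hc 0 _).2]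
      ring
    · refine (measure_exists_lt_abs_uSeq_one_le hgm hgc (a := -a) hb0 (by norm_num; positivity)
        (fun s => ?_) hN).trans (ENNReal.ofReal_le_ofReal (le_of_eq ?_))
      · have := clip_mem_Icc hb0.le (h s)
        rw [hga]
        constructor <;> linarith [this.1, this.2]
      · congr 2
        rw [mul_pow, mul_pow, rpow_half_sq, hby]
        norm_num
        field_simp
        norm_num
  · obtain ⟨g, hgm, hgb, hgc, hgL⟩ := exists_centered_on hh hc hfm hfb Finset.univ
    have hgc' : Centered ν g := fun q s =>
      ⟨integrable_update hgm hgb q s, hgc q (Finset.mem_univ q) s⟩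
    have hfac : (2 : ℝ) * 36 ^ 2 ≤ (r + 1).factorial * 36 ^ (r + 1) := by
      have h1 : 2 ≤ (r + 1).factorial := by
        calc 2 = Nat.factorial 2 := rfl
          _ ≤ _ := Nat.factorial_le (by omega)
      have h1' : (2 : ℝ) ≤ (r + 1).factorial := by exact_mod_cast h1
      have h2 : (36 : ℝ) ^ 2 ≤ 36 ^ (r + 1) := pow_le_pow_right₀ (by norm_num) (by omega)
      gcongr
    -- The remainder gets only $1/40$ of the level: enough because $2\cdot36^2\ge40^2$, and the rest
    -- is left to the bounded kernel.
    refine (measure_exists_lt_abs_le_add hh hc hgm hgc' hN hx hy (by norm_num : (0 : ℝ) < 1 / 40)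
      hxy (by nlinarith) hgL).trans (add_le_add ?_ le_rfl)
    have hgy : ∀ s, |g s| ≤ y := by
      intro s
      refine (hgb s).trans ?_
      rw [Finset.card_univ, Fintype.card_fin]
      have := mul_le_mul_of_nonneg_left (two_pow_mul_constC_le (r + 1)) hy.le
      rw [hb]
      linarith
    rw [show (1 : ℝ) - 1 / 40 = 39 / 40 by norm_num]
    refine (measure_exists_lt_abs_le_of_bounded hgm hgc' hr hN hx hy hxy hgy).trans
      (ENNReal.ofReal_le_ofReal ?_)
    linarith [Real.exp_pos (-(1 / 2) * (x / y) ^ ((2 : ℝ) / (r + 1 : ℕ)))]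

end Assembly

end UStat

/-! ### Transfer from the law of the sequence to the given variables -/

theorem theorem1 {Ω S : Type*} [MeasurableSpace Ω] [MeasurableSpace S]
    (μ : Measure Ω) [IsProbabilityMeasure μ]
    (r : ℕ) (hr : 1 ≤ r)
    (h : (Fin r → S) → ℝ) (hh : Measurable h)
    (X : ℕ → Ω → S) (hX : ∀ i, Measurable (X i))
    (hindep : iIndepFun X μ) (hident : ∀ i, IdentDistrib (X i) (X 0) μ μ)
    (hdeg : UStat.IsDegenerate h (X 0) μ)
    (N : ℕ) (hN : r ≤ N) (x y : ℝ) (hx : 0 < x) (hy : 0 < y) (hxy : 3 ^ r < x / y) :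
    μ {ω | (N : ℝ) ^ ((r : ℝ) / 2) * x <
        (Finset.Icc r N).sup' (Finset.nonempty_Icc.2 hN) fun n => |UStat.uStat h X n ω|} ≤
      ENNReal.ofReal (UStat.constA r * Real.exp (-(1 / 2) * (x / y) ^ ((2 : ℝ) / r))) +
      ENNReal.ofReal (UStat.constB r) *
        ∫⁻ u in Set.Ioi (1 : ℝ),
          μ {ω | y * u ^ ((1 : ℝ) / 2) * UStat.constC r < |h fun k => X k ω|} *
            ENNReal.ofReal ((1 + Real.log u) ^ ((r : ℝ) * ((r : ℝ) - 1) / 2)) := by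
  obtain ⟨r, rfl⟩ : ∃ k, r = k + 1 := ⟨r - 1, by omega⟩
  set ν : Measure S := μ.map (X 0) with hν
  have : IsProbabilityMeasure ν := Measure.isProbabilityMeasure_map (hX 0).aemeasurable
  have hF : Measurable fun ω i => X i ω := measurable_pi_lambda _ hX
  have hmap : μ.map (fun ω i => X i ω) = UStat.seqLaw ν := by
    rw [hindep.map_fun_eq_infinitePi_map hX]
    congr 1
    funext i
    exact (hident i).map_eq
  have hcen : UStat.Centered ν h := by
    intro q s
    have hm : AEStronglyMeasurable (fun t => h (Function.update s q t)) (μ.map (X 0)) :=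
      (hh.comp (measurable_update s)).aestronglyMeasurable
    refine ⟨(integrable_map_measure hm (hX 0).aemeasurable).2 (hdeg q s).1, ?_⟩
    rw [hν, integral_map (hX 0).aemeasurable hm]
    exact (hdeg q s).2
  have hlhs : μ {ω | (N : ℝ) ^ (((r + 1 : ℕ) : ℝ) / 2) * x <
        (Finset.Icc (r + 1) N).sup' (Finset.nonempty_Icc.2 hN) fun n => |UStat.uStat h X n ω|} ≤
      UStat.seqLaw ν {ξ | ∃ n ≤ N,
        (N : ℝ) ^ (((r + 1 : ℕ) : ℝ) / 2) * x < |UStat.uSeq h n ξ|} := by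
    rw [← hmap]
    refine le_trans (measure_mono fun ω hω => ?_) (Measure.le_map_apply hF.aemeasurable _)
    rw [Set.mem_ofPred_eq, Finset.lt_sup'_iff] at hω
    obtain ⟨n, hn, hlt⟩ := hω
    exact ⟨n, (Finset.mem_Icc.1 hn).2, hlt⟩
  refine hlhs.trans ((UStat.measure_exists_lt_abs_uSeq_le hh hcen hN hx hy hxy).trans ?_)
  refine add_le_add (ENNReal.ofReal_le_ofReal ?_) (mul_le_mul_right ?_ _)
  · have := UStat.two_le_constA hr
    gcongr
  · refine setLIntegral_mono_ae' measurableSet_Ioi (Filter.Eventually.of_forall fun u hu => ?_)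
    have hu1 : (1 : ℝ) < u := hu
    rw [← hmap, Measure.map_apply hF
      (measurableSet_lt measurable_const (UStat.measurable_comp_val hh).abs)]
    -- The logarithmic weight is at least one for `u > 1`, so the unweighted tail integral is the
    -- smaller one.
    have hw : 1 ≤ ENNReal.ofReal
        ((1 + Real.log u) ^ (((r + 1 : ℕ) : ℝ) * (((r + 1 : ℕ) : ℝ) - 1) / 2)) := by
      rw [ENNReal.one_le_ofReal]
      refine Real.one_le_rpow (by linarith [Real.log_pos hu1]) ?_
      push_cast
      have : (0 : ℝ) ≤ r := Nat.cast_nonneg r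
      have : 0 ≤ ((r : ℝ) + 1) * r := by positivity
      linarith
    refine le_trans (le_of_eq ?_) (le_mul_of_one_le_right' hw)
    simp only [Set.preimage_ofPred_eq, mul_right_comm]
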